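/- **Setting.** *Building blocks.* Let $A_n=\{(f,a)\in C([0,1],E_n)\oplus F_n : f(\mathfrak r)=\beta_{n,\mathfrak r}(a),\ \mathfrak r=0,1\}$, where $E_n=\bigoplus_p E_n^p$ and $F_n=\bigoplus_i F_n^i$ are finite direct sums of full matrix algebras, and every $\beta_{n,\mathfrak r}^p\colon F_n\to E_n^p$ is a composition $F_n\to\bigoplus_i 1_{\mathcal M_\mathfrak r(p,i)}\otimes F_n^i\subseteq\bigoplus_i M_{\mathcal M_\mathfrak r(p,i)}\otimes F_n^i\rightarrowtail E_n^p$ with finite sets $\mathcal M_\mathfrak r(p,i)$. Here and below $\rightarrowtail$ is a $*$-homomorphism of multiplicity one given by an injection of the index sets of the diagonal matrix units. Either all $\beta_{n,\mathfrak r}^p$ are unital (unital case), or there is exactly one index $\grave p$ for which $\beta_{n,1}^{\grave p}$ is not unital, and $\beta_{n,0}^{\grave p}$ and all $\beta_{n,\mathfrak r}^p$, $p\neq\grave p$, are unital (stably projectionless case). Let $\mathcal E_n=\coprod_p\mathcal E_n^p$ and $\mathcal F_n=\coprod_i\mathcal F_n^i$ be the discrete groupoids of matrix units of $E_n$ and $F_n$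 (disjoint unions of full equivalence relations). Let $\mathcal E_{n,\mathfrak r}=\coprod_{p,i}\mathcal M_\mathfrak r(p,i)\times\mathcal F_n^i\subseteq\mathcal E_n$ and let $\boldsymbol b_{n,\mathfrak r}\colon\mathcal E_{n,\mathfrak r}\to\mathcal F_n$, $(\mu,\eta)\mapsto\eta$. Put $[0,1]\times_\bullet\mathcal E_n=\{(t,\gamma)\in[0,1]\times\mathcal E_n:\gamma\in\mathcal E_{n,t}\text{ if }t\in\{0,1\}\}$ and $G_n=\big(([0,1]\times_\bullet\mathcal E_n)\amalg\mathcal F_n\big)/\!\sim$ with the quotient topology, where $(\mathfrak r,\gamma)\sim\boldsymbol b_{n,\mathfrak r}(\gamma)$ for $\gamma\in\mathcal E_{n,\mathfrak r}$. *Connecting maps.* Let $\varphi_n\colon A_n\to A_{n+1}$ be a connecting map as produced by modification (path), that is, of the following form. The block $A_{n+1}$, with indices $q,j$ instead of $p,i$, arises from a building block $\dot A_{n+1}=\{(f,a)\in C([0,1],\dot E_{n+1})\oplus F_{n+1}: f(\mathfrak r)=\dot\beta_{n+1,\mathfrak r}(a)\}$ and a homomorphism $\dot\varphi_n=(\dot\varphi_C,\varphi_F)\colon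 A_n\to\dot A_{n+1}$. The blocks $A_n$ and $\dot A_{n+1}$ are both in the unital case or both in the stably projectionless case; in the latter $\grave q$ denotes the exceptional index of $\dot A_{n+1}$, and in the unital case no index is equal to $\grave p$ or $\grave q$. * There are pairwise distinct indices $j_0^p$ (all $p$), $j_1^p$ (all $p\neq\grave p$) and finite sets $\mathcal M(j,i)$ such that $\varphi_F^j(f,a)$ is the image under some $\rightarrowtail$ of $\big(f^p(\tfrac12),(1_{\mathcal M(j,i)}\otimes a^i)_i\big)$ if $j=j_0^p$ or $j=j_1^p$, and of $(1_{\mathcal M(j,i)}\otimes a^i)_i$ for all other $j$. * Let $\lambda^+(t)=\tfrac12+\tfrac t2$, $\lambda_+(t)=\tfrac t2$, $\lambda^-(t)=1-\tfrac t2$, $\lambda_-(t)=\tfrac12-\tfrac t2$. There are finite sets $\mathcal M^+(q,p)$, $\mathcal M_+(q,p)$, $\mathcal M^-(q,p)$, $\mathcal M_-(q,p)$, $\underline{\mathcal M}(q,p)$, $\overline{\mathcal M}(q,p)$, $\mathcal M^{q,i}$ such that $\dot\varphi_C^q(f,a)$ is the image under some $\rightarrowtail$ of the block diagonal function with one block $f^p\circ\lambda_\mu$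 for every $p$ and every $\mu$ in one of the first six sets, where $\lambda_\mu=\lambda^+,\lambda_+,\lambda^-,\lambda_-$ for $\mu$ in the first four sets, respectively, and $\lambda_\mu\equiv\tfrac12$ for $\mu$ in the last two, and one constant block $a^i$ for every $i$ and every $\mu\in\mathcal M^{q,i}$. * $\mathcal M^+(q,p),\mathcal M_+(q,p),\mathcal M^-(q,p),\mathcal M_-(q,p)\neq\emptyset$ for all $q\neq\grave q$, $p\neq\grave p$. In the stably projectionless case, $\mathcal M^+(\grave q,\grave p)\neq\emptyset$, and $\mathcal M_+(\grave q,\grave p)\neq\emptyset$ or $\mathcal M_-(\grave q,\grave p)\neq\emptyset$. If there is an index $p\neq\grave p$, then there is an index $q\neq\grave q$. * For some index $\mathfrak q$, $E_{n+1}^{\mathfrak q}$ is a full matrix algebra containing $\dot E_{n+1}^{\mathfrak q}\oplus F_{n+1}$ diagonally with unit the sum of the two units, $\beta_{n+1,0}^{\mathfrak q}=\dot\beta_{n+1,0}^{\mathfrak q}\oplus\mathrm{id}_{F_{n+1}}$, $\beta_{n+1,1}^{\mathfrak q}=\dot\beta_{n+1,1}^{\mathfrak q}\oplus\mathrm{Ad}(w)|_{F_{n+1}}$,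 and $\varphi_C^{\mathfrak q}=\dot\varphi_C^{\mathfrak q}\oplus\varphi_F$ (with $\varphi_F(f,a)$ viewed as a constant function). For $q\neq\mathfrak q$, $E_{n+1}^q=\dot E_{n+1}^q$, $\beta_{n+1,\mathfrak r}^q=\dot\beta_{n+1,\mathfrak r}^q$ and $\varphi_C^q=\dot\varphi_C^q$. Here $w$ is a permutation matrix which exchanges identically the copies of $E_n^p$ in $F_{n+1}^{j_0^p}$ and $F_{n+1}^{j_1^p}$ for all $p\neq\grave p$, fixes the copy of $E_n^{\grave p}$, for every $i$ permutes cyclically (in one cycle, identically on $F_n^i$) the copies of $F_n^i$ in $F_{n+1}$ labelled by $\coprod_j\mathcal M(j,i)$, and fixes all other positions. *The map $\boldsymbol p$.* For $q\neq\mathfrak q$ let $\mathcal E_{n+1}^q[\boldsymbol p]\subseteq\mathcal E_{n+1}^q$ be the set of all $(\mu,\gamma)$, where $\mu$ labels a block of $\dot\varphi_C^q$ and $\gamma\in\mathcal E_n^p$ or $\gamma\in\mathcal F_n^i$, respectively, is a matrix unit of that block. Let $\mathcal F_{n+1}[\boldsymbol p]\subseteq\mathcal F_{n+1}$ be the set of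 matrix units inside the blocks of $\varphi_F$. Define $\mathcal E_{n+1}^{\mathfrak q}[\boldsymbol p]$ in the same way, but with an additional copy of $\mathcal F_{n+1}[\boldsymbol p]$. Let $\mathcal E_{n+1,\mathfrak r}[\boldsymbol p]$ consist of all elements of $\mathcal E_{n+1}[\boldsymbol p]=\coprod_q\mathcal E_{n+1}^q[\boldsymbol p]$, except that $(\mu,\gamma)$ with $\gamma\in\mathcal E_n^p$ and $\lambda_\mu(\mathfrak r)\in\{0,1\}$ belongs to it only if $\gamma\in\mathcal E_{n,\lambda_\mu(\mathfrak r)}$. Put $H_n=\big(([0,1]\times_\bullet\mathcal E_{n+1}[\boldsymbol p])\amalg\mathcal F_{n+1}[\boldsymbol p]\big)/\!\sim\ \subseteq G_{n+1}$, and let $\boldsymbol p=\boldsymbol p_n\colon H_n\to G_n$ be given by $\boldsymbol p[t,(\mu,\gamma)]=[\lambda_\mu(t),\gamma]$ for $\gamma\in\mathcal E_n^p$, $\boldsymbol p[t,(\mu,\gamma)]=\gamma$ for $\gamma\in\mathcal F_n^i$, on $\mathcal F_{n+1}[\boldsymbol p]$ by $\boldsymbol p(\gamma)=[\tfrac12,\gamma]$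 for $\gamma$ in a copy of $\mathcal E_n^p$ and $\boldsymbol p(\mu,\gamma)=\gamma$ for $\gamma\in\mathcal F_n^i$, and by $\boldsymbol p[t,\gamma]=\boldsymbol p(\gamma)$ on the additional copy of $\mathcal F_{n+1}[\boldsymbol p]$. *Paths.* A value $w$ is a stop value of a function $\omega$ on a closed interval $I$ if $\omega$ is constant with value $w$ on some closed subinterval of $I$ of positive length. For a path $\xi$ in $G_n$ (or $G_{n+1}$) consider the following properties. * (P1) There are $0=\mathfrak t_0<\mathfrak t_1<\dots<\mathfrak t_{D+1}=1$, $D\ge0$, and, for every $0\le d\le D$, with $I_d=[\mathfrak t_d,\mathfrak t_{d+1}]$, an element $\gamma_d\in\mathcal E_n$ (resp. $\mathcal E_{n+1}$) and a continuous monotone function $\omega_d\colon I_d\to[0,1]$ whose set of stop values is exactly $\omega_d(I_d)\cap\mathbb Z[\tfrac12]$, such that $\xi(t)=[\omega_d(t),\gamma_d]$ for all $t\in I_d$. * (P2) For some $d$, one of $0,\tfrac12,1$ is a stop value of $\omega_d$. **Proposition.** Let $\xi_n\colon[0,1]\to G_n$ be a continuous path with (P1) and (P2), and let $\xi_{n+1}^0,\xi_{n+1}^1\in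 H_n$ satisfy $\boldsymbol p(\xi_{n+1}^{\mathfrak r})=\xi_n(\mathfrak r)$ for $\mathfrak r=0,1$. Then there is a continuous path $\xi_{n+1}\colon[0,1]\to H_n$ with (P1) and (P2) such that $\xi_{n+1}(\mathfrak r)=\xi_{n+1}^{\mathfrak r}$ for $\mathfrak r=0,1$ and $\boldsymbol p\circ\xi_{n+1}=\xi_n$. **Variation.** Let $R\subseteq\{0,1\}$, and write $d_0=0$, $d_1=D$. Say that (P1) holds with exception at $R$ if in (P1) the set of stop values of $\omega_d$ is instead, for every $d$, the set $\omega_d(I_d)\cap\mathbb Z[\tfrac12]$ without the values $\omega_{d_{\mathfrak r}}(\mathfrak r)$ for the $\mathfrak r\in R$ with $d=d_{\mathfrak r}$. Suppose that $\xi_n$ is continuous and satisfies (P1) with exception at $R$ and (P2), that $\boldsymbol p(\xi_{n+1}^{\mathfrak r})=\xi_n(\mathfrak r)$ for $\mathfrak r=0,1$, and that for every $\mathfrak r\in R$: * (P3a) $\omega_{d_{\mathfrak r}}(\mathfrak r)\in\{0,1\}$ is not a stop value of $\omega_{d_{\mathfrak r}}$. * (P3b) There are $w\in\{0,1\}$ and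 $\mu$ in one of the six sets $\mathcal M^+(q,p),\dots,\overline{\mathcal M}(q,p)$, where $p$ is such that $\gamma_{d_{\mathfrak r}}\in\mathcal E_n^p$, with $\xi_{n+1}^{\mathfrak r}=[w,(\mu,\gamma_{d_{\mathfrak r}})]$. Moreover, let $\mathfrak t$ be the first time $>0$ (if $\mathfrak r=0$), respectively the last time $<1$ (if $\mathfrak r=1$), at which $\omega_d(\mathfrak t)\in\{0,\tfrac12,1\}$ for some $d$ with $\mathfrak t\in I_d$; this time exists, and all values $\omega_d(t)$, for $t\in I_d$ between $\mathfrak r$ and $\mathfrak t$ (inclusive) and those $d$ for which $I_d$ contains a point strictly on the same side of $\mathfrak t$ as $\mathfrak r$, belong to the image of $\lambda_\mu$. Then there is a continuous path $\xi_{n+1}\colon[0,1]\to H_n$ such that $\xi_{n+1}(\mathfrak r)=\xi_{n+1}^{\mathfrak r}$ for $\mathfrak r=0,1$, $\boldsymbol p\circ\xi_{n+1}=\xi_n$, and $\xi_{n+1}$ satisfies, with respect to one and the same choice of points $\mathfrak t_d$, elements $\gamma_d$ and functions $\omega_d$, (P1) with exception at $R$, (P2), and (P3a) for all $\mathfrak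 r\in R$. (The case $R=\emptyset$ is the Proposition.) -/

import Mathlib

/-! ## Endpoints and block embeddings -/

/-- The endpoint `𝔯 ∈ {0,1}` of the unit interval; `false` stands for `0` and `true` for `1`. -/
def endpt : Bool → unitInterval
  | false => 0
  | true => 1

theorem endpt_injective : Function.Injective endpt := by
  intro a b h
  cases a <;> cases b <;> simp_all [endpt]

/-- The midpoint of the unit interval. -/
noncomputable def halfPt : unitInterval := ⟨1 / 2, by norm_num, by norm_num⟩

open Classical in
/-- The `*`-homomorphism of multiplicity one which sends diagonal matrices to diagonal matrices and
which is determined by an injection `e` of the disjoint union of the index sets `X b` into `Y`: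
a family of matrices is put on the diagonal as blocks, placed according to `e`, and
extended by zero outside of the range of `e`. -/
noncomputable def pushBlocks {B : Type} {X : B → Type} {Y : Type} (e : (Σ b, X b) → Y)
    (m : ∀ b, Matrix (X b) (X b) ℂ) : Matrix Y Y ℂ := fun y y' =>
  if h : (∃ z, e z = y) ∧ (∃ z', e z' = y') then
    Matrix.blockDiagonal' m h.1.choose h.2.choose else 0

theorem pushBlocks_apply {B : Type} {X : B → Type} {Y : Type} {e : (Σ b, X b) → Y}
    (he : Function.Injective e) (m : ∀ b, Matrix (X b) (X b) ℂ) (b : B) (x x' : X b) :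
    pushBlocks e m (e ⟨b, x⟩) (e ⟨b, x'⟩) = m b x x' := by
  classical
  have h : (∃ z, e z = e ⟨b, x⟩) ∧ (∃ z', e z' = e ⟨b, x'⟩) := ⟨⟨_, rfl⟩, ⟨_, rfl⟩⟩
  have h1 : h.1.choose = ⟨b, x⟩ := he h.1.choose_spec
  have h2 : h.2.choose = ⟨b, x'⟩ := he h.2.choose_spec
  unfold pushBlocks
  rw [dif_pos h, h1, h2]
  simp [Matrix.blockDiagonal'_apply]

theorem exists_of_pushBlocks_ne_zero {B : Type} {X : B → Type} {Y : Type} {e : (Σ b, X b) → Y}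
    (m : ∀ b, Matrix (X b) (X b) ℂ) (y y' : Y) (h : pushBlocks e m y y' ≠ 0) :
    ∃ (b : B) (x x' : X b), e ⟨b, x⟩ = y ∧ e ⟨b, x'⟩ = y' := by
  classical
  unfold pushBlocks at h
  split_ifs at h with h0
  · have e1 := h0.1.choose_spec
    have e2 := h0.2.choose_spec
    generalize h0.1.choose = z at h e1
    generalize h0.2.choose = z' at h e2
    obtain ⟨b, x⟩ := z
    obtain ⟨b', x'⟩ := z'
    by_cases hb : b = b'
    · subst hb
      exact ⟨b, x, x', e1, e2⟩
    · exact absurd (Matrix.blockDiagonal'_apply_ne m x x' hb) h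
  · exact absurd rfl h

/-! ## One-dimensional NCCW complexes and their groupoid models -/

/-- A one-dimensional NCCW complex
`{(f,a) ∈ C([0,1],E) ⊕ F : f(𝔯) = β_𝔯(a) for 𝔯 = 0,1}` with `E = ⨁_p E^p`, `F = ⨁_i F^i`,
presented by finite sets.  The summand `E^p` is the algebra of matrices with index set `Y p`, the
summand `F^i` is the algebra of matrices with index set `X i`, and
`β_𝔯^p : F → E^p` is the composition
`F → ⨁_i 1_{M_𝔯(p,i)} ⊗ F^i ⊆ ⨁_i M_{M_𝔯(p,i)} ⊗ F^i ↣ E^p`, the arrow `↣` being given by the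
injection `emb r p`.  Either all the `β_𝔯^p` are unital (`grave = none`, the unital case), or there
is exactly one index `p̀` (`grave = some p̀`, the stably projectionless case) such that `β_1^p̀` is
not unital, `β_0^p̀` and all the other `β_𝔯^p` being unital. -/
structure BuildingBlock where
  P : Type
  I : Type
  Y : P → Type
  X : I → Type
  M : Bool → P → I → Type
  finP : Finite P
  finI : Finite I
  finY : ∀ p, Finite (Y p)
  finX : ∀ i, Finite (X i)
  finM : ∀ r p i, Finite (M r p i)
  emb : ∀ r p, (Σ b : (Σ i, M r p i), X b.1) → Y p
  emb_injective : ∀ r p, Function.Injective (emb r p)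
  grave : Option P
  unital_zero : ∀ p, Function.Surjective (emb false p)
  unital_one : ∀ p, Function.Surjective (emb true p) ↔ grave ≠ some p

namespace BuildingBlock

/-- Pairs `(f,a)` of a function `f : [0,1] → E` and an element `a ∈ F`. -/
abbrev Pairs (A : BuildingBlock) : Type :=
  (unitInterval → ∀ p, Matrix (A.Y p) (A.Y p) ℂ) × (∀ i, Matrix (A.X i) (A.X i) ℂ)

/-- The `*`-homomorphism `β_𝔯 : F → E`. -/
noncomputable def beta (A : BuildingBlock) (r : Bool) (a : ∀ i, Matrix (A.X i) (A.X i) ℂ) :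
    ∀ p, Matrix (A.Y p) (A.Y p) ℂ :=
  fun p => pushBlocks (A.emb r p) (fun b => a b.1)

/-- The underlying set of the one-dimensional NCCW complex. -/
def alg (A : BuildingBlock) : Set A.Pairs :=
  {x | Continuous x.1 ∧ ∀ r, x.1 (endpt r) = A.beta r x.2}

/-- The groupoid model `𝓔 = ∐_p 𝓔^p` of `E`: the disjoint union of the full equivalence relations
on the sets `Y p`. -/
def E (A : BuildingBlock) : Type := Σ p, A.Y p × A.Y p

/-- The groupoid model `𝓕 = ∐_i 𝓕^i` of `F`. -/
def F (A : BuildingBlock) : Type := Σ i, A.X i × A.X i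

instance (A : BuildingBlock) : TopologicalSpace A.E := ⊥
instance (A : BuildingBlock) : TopologicalSpace A.F := ⊥
instance (A : BuildingBlock) : DiscreteTopology A.E := ⟨rfl⟩
instance (A : BuildingBlock) : DiscreteTopology A.F := ⟨rfl⟩

/-- The graph of the partially defined groupoid morphism `𝒃_𝔯` from `𝓔` to `𝓕` which induces `β_𝔯`:
under `𝓔_𝔯^p ≅ ∐_i 𝓜_𝔯(p,i) × 𝓕^i`, it sends `(μ,η)` to `η`. -/
def bGraph (A : BuildingBlock) (r : Bool) (γ : A.E) (η : A.F) : Prop :=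
  ∃ μ : A.M r γ.1 η.1,
    A.emb r γ.1 ⟨⟨η.1, μ⟩, η.2.1⟩ = γ.2.1 ∧ A.emb r γ.1 ⟨⟨η.1, μ⟩, η.2.2⟩ = γ.2.2

/-- The domain `𝓔_𝔯` of `𝒃_𝔯`. -/
def dom (A : BuildingBlock) (r : Bool) : Set A.E := {γ | ∃ η, A.bGraph r γ η}

/-- `(t,γ)` belongs to `[0,1] ×_• 𝓔`, i.e. `γ ∈ 𝓔_t` if `t = 0,1`. -/
def Adm (A : BuildingBlock) (t : unitInterval) (γ : A.E) : Prop :=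
  ∀ r, t = endpt r → γ ∈ A.dom r

/-- `([0,1] ×_• 𝓔) ∐ 𝓕`. -/
abbrev PreG (A : BuildingBlock) : Type :=
  {x : unitInterval × A.E // A.Adm x.1 x.2} ⊕ A.F

/-- The identifications `(𝔯,γ) ∼ 𝒃_𝔯(γ)`. -/
inductive Glue (A : BuildingBlock) : A.PreG → A.PreG → Prop
  | mk (r : Bool) (γ : A.E) (h : A.Adm (endpt r) γ) (η : A.F) (hb : A.bGraph r γ η) :
      Glue A (Sum.inl ⟨(endpt r, γ), h⟩) (Sum.inr η)

/-- The space of the groupoid model `(([0,1] ×_• 𝓔) ∐ 𝓕) / ∼`, with the quotient topology. -/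
def G (A : BuildingBlock) : Type := Quot A.Glue

instance (A : BuildingBlock) : TopologicalSpace A.G :=
  inferInstanceAs (TopologicalSpace (Quot A.Glue))

/-- The class `[t,γ]`. -/
def edge (A : BuildingBlock) (t : unitInterval) (γ : A.E) (h : A.Adm t γ) : A.G :=
  Quot.mk _ (Sum.inl ⟨(t, γ), h⟩)

/-- The class of `η ∈ 𝓕`. -/
def vertex (A : BuildingBlock) (η : A.F) : A.G := Quot.mk _ (Sum.inr η)

theorem edge_eq_vertex (A : BuildingBlock) {r : Bool} {γ : A.E} (h : A.Adm (endpt r) γ) {η : A.F}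
    (hb : A.bGraph r γ η) : A.edge (endpt r) γ h = A.vertex η :=
  Quot.sound (Glue.mk r γ h η hb)

/-! Evaluation of elements of the complex at the points of the groupoid model. -/

/-- The entry of `(f,a)` at a representative of a point of the groupoid model. -/
def evPre (A : BuildingBlock) (x : A.Pairs) : A.PreG → ℂ
  | .inl z => x.1 z.1.1 z.1.2.1 z.1.2.2.1 z.1.2.2.2
  | .inr η => x.2 η.1 η.2.1 η.2.2

theorem alg_apply (A : BuildingBlock) {x : A.Pairs} (hx : x ∈ A.alg) {r : Bool} {γ : A.E} {η : A.F}
    (hb : A.bGraph r γ η) : x.1 (endpt r) γ.1 γ.2.1 γ.2.2 = x.2 η.1 η.2.1 η.2.2 := by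
  obtain ⟨μ, h1, h2⟩ := hb
  rw [hx.2 r, ← h1, ← h2]
  exact pushBlocks_apply (X := fun b : (Σ i, A.M r γ.1 i) => A.X b.1) (A.emb_injective r γ.1)
    (fun b => x.2 b.1) ⟨η.1, μ⟩ _ _

/-- The entry of an element `(f,a)` of the complex at a point of the groupoid model. -/
def ev (A : BuildingBlock) (x : A.Pairs) (hx : x ∈ A.alg) : A.G → ℂ :=
  Quot.lift (A.evPre x) (by
    rintro _ _ ⟨r, γ, h, η, hb⟩
    exact A.alg_apply hx hb)

theorem beta_zero (A : BuildingBlock) (r : Bool) : A.beta r 0 = 0 := by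
  funext p
  ext u u'
  by_contra h
  obtain ⟨b, x, x', rfl, rfl⟩ := exists_of_pushBlocks_ne_zero _ _ _ h
  exact h (pushBlocks_apply (X := fun b : (Σ i, A.M r p i) => A.X b.1) (A.emb_injective r p)
    (fun _ => 0) b x x')

theorem exists_bump (A : BuildingBlock) (t t' : unitInterval) (ht : ∀ r, t ≠ endpt r) (γ : A.E) :
    ∃ x ∈ A.alg, x.2 = 0 ∧ x.1 t γ.1 γ.2.1 γ.2.2 ≠ 0 ∧
      (∀ s δ, δ ≠ γ → x.1 s δ.1 δ.2.1 δ.2.2 = 0) ∧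
      (t' ≠ t → ∀ δ : A.E, x.1 t' δ.1 δ.2.1 δ.2.2 = 0) := by
  classical
  have h0 : (t : ℝ) ≠ 0 := fun h => ht false (Subtype.ext h)
  have h1 : (t : ℝ) ≠ 1 := fun h => ht true (Subtype.ext h)
  obtain ⟨g, hg, hgt, hgt'⟩ : ∃ g : ℝ → ℝ, Continuous g ∧ g t ≠ 0 ∧ (t' ≠ t → g t' = 0) := by
    by_cases htt : t' = t
    · exact ⟨fun _ => 1, continuous_const, one_ne_zero, fun h => absurd htt h⟩
    · refine ⟨fun s => s - t', by fun_prop, ?_, fun _ => sub_self _⟩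
      exact sub_ne_zero.2 (fun h => htt (Subtype.ext h.symm))
  refine ⟨(fun s p u u' => (((s : ℝ) * (1 - s) * g s : ℝ) : ℂ) *
      (if (⟨p, u, u'⟩ : A.E) = γ then 1 else 0), 0), ⟨?_, ?_⟩, rfl, ?_, ?_, ?_⟩
  · fun_prop
  · intro r
    rw [A.beta_zero]
    funext p
    ext u u'
    cases r <;> simp [endpt]
  · change (((t : ℝ) * (1 - t) * g t : ℝ) : ℂ) * (if γ = γ then 1 else 0) ≠ 0
    rw [if_pos rfl, mul_one]
    exact_mod_cast mul_ne_zero (mul_ne_zero h0 (sub_ne_zero.2 (Ne.symm h1))) hgt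
  · intro s δ hδ
    change (((s : ℝ) * (1 - s) * g s : ℝ) : ℂ) * (if δ = γ then 1 else 0) = 0
    rw [if_neg hδ, mul_zero]
  · intro h δ
    simp [hgt' h]

open Classical in
theorem exists_vertex_indicator (A : BuildingBlock) (η : A.F) :
    ∃ x ∈ A.alg, ∀ δ : A.F, x.2 δ.1 δ.2.1 δ.2.2 = if δ = η then 1 else 0 := by
  let a : ∀ i, Matrix (A.X i) (A.X i) ℂ := fun i u u' => if (⟨i, u, u'⟩ : A.F) = η then 1 else 0
  refine ⟨(fun s p => ((1 - s : ℝ) : ℂ) • A.beta false a p + ((s : ℝ) : ℂ) • A.beta true a p, a),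
    ⟨?_, ?_⟩, ?_⟩
  · fun_prop
  · intro r
    funext p
    cases r <;> simp [endpt]
  · intro δ
    rfl

theorem edge_or_vertex (A : BuildingBlock) (g : A.G) :
    (∃ η, g = A.vertex η) ∨ ∃ t γ h, (∀ r, t ≠ endpt r) ∧ g = A.edge t γ h := by
  induction g using Quot.ind with
  | mk z =>
    rcases z with ⟨⟨t, γ⟩, h⟩ | η
    · by_cases ht : ∀ r, t ≠ endpt r
      · exact Or.inr ⟨t, γ, h, ht, rfl⟩
      · push Not at ht
        obtain ⟨r, hr⟩ := ht
        obtain ⟨η, hη⟩ := h r hr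
        change t = _ at hr
        subst hr
        exact Or.inl ⟨η, A.edge_eq_vertex h hη⟩
    · exact Or.inl ⟨η, rfl⟩

theorem exists_ev_ne_zero (A : BuildingBlock) (g : A.G) : ∃ x, ∃ hx : x ∈ A.alg, A.ev x hx g ≠ 0 := by
  rcases A.edge_or_vertex g with ⟨η, rfl⟩ | ⟨t, γ, h, ht, rfl⟩
  · obtain ⟨x, hx, hη⟩ := A.exists_vertex_indicator η
    refine ⟨x, hx, ?_⟩
    change x.2 η.1 η.2.1 η.2.2 ≠ 0
    simp [hη]
  · obtain ⟨x, hx, -, h1, -⟩ := A.exists_bump t t ht γ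
    exact ⟨x, hx, h1⟩

/-- The complex separates the points of its groupoid model. -/
theorem eq_of_ev_eq (A : BuildingBlock) {g g' : A.G}
    (h : ∀ x (hx : x ∈ A.alg), A.ev x hx g = A.ev x hx g') : g = g' := by
  rcases A.edge_or_vertex g with ⟨η, rfl⟩ | ⟨t, γ, hγ, ht, rfl⟩ <;>
    rcases A.edge_or_vertex g' with ⟨η', rfl⟩ | ⟨t', γ', hγ', ht', rfl⟩
  · obtain ⟨x, hx, hη⟩ := A.exists_vertex_indicator η
    have h1 : x.2 η.1 η.2.1 η.2.2 = x.2 η'.1 η'.2.1 η'.2.2 := h x hx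
    rw [hη, hη, if_pos rfl] at h1
    by_cases h2 : η' = η
    · rw [h2]
    · simp [h2] at h1
  · obtain ⟨x, hx, ha, h1, -⟩ := A.exists_bump t' t' ht' γ'
    have h2 : x.2 η.1 η.2.1 η.2.2 = x.1 t' γ'.1 γ'.2.1 γ'.2.2 := h x hx
    rw [ha] at h2
    exact absurd h2.symm h1
  · obtain ⟨x, hx, ha, h1, -⟩ := A.exists_bump t t ht γ
    have h2 : x.1 t γ.1 γ.2.1 γ.2.2 = x.2 η'.1 η'.2.1 η'.2.2 := h x hx
    rw [ha] at h2
    exact absurd h2 h1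
  · obtain ⟨x, hx, -, h1, h3, h4⟩ := A.exists_bump t t' ht γ
    have h2 : x.1 t γ.1 γ.2.1 γ.2.2 = x.1 t' γ'.1 γ'.2.1 γ'.2.2 := h x hx
    by_cases htt : t' = t
    · subst htt
      by_cases hg : γ' = γ
      · subst hg; rfl
      · rw [h3 _ _ hg] at h2
        exact absurd h2 h1
    · rw [h4 htt] at h2
      exact absurd h2 h1

/-- The indices `𝔯` for which the index `j_𝔯^p` is used: `j_1^p̀` does not occur. -/
def Slot (A : BuildingBlock) (p : A.P) : Type := {s : Bool // s = true → A.grave ≠ some p}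

open Classical in
/-- The exchange of `j_0^p` and `j_1^p` for `p ≠ p̀`, and the identity for `p = p̀`. -/
noncomputable def flipFun (A : BuildingBlock) (p : A.P) (s : A.Slot p) : A.Slot p :=
  if h : A.grave = some p then s else ⟨!s.1, fun _ => h⟩

theorem flipFun_flipFun (A : BuildingBlock) (p : A.P) (s : A.Slot p) :
    A.flipFun p (A.flipFun p s) = s := by
  by_cases h : A.grave = some p
  · simp [flipFun, h]
  · exact Subtype.ext (by simp [flipFun, h])

/-- The exchange of `j_0^p` and `j_1^p` for `p ≠ p̀` as a permutation. -/
noncomputable def flip (A : BuildingBlock) (p : A.P) : Equiv.Perm (A.Slot p) :=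
  ⟨A.flipFun p, A.flipFun p, A.flipFun_flipFun p, A.flipFun_flipFun p⟩

end BuildingBlock

/-! ## Blocks of the connecting map -/

/-- The six types of block diagonal entries of `φ_C` that come from `C([0,1],E_n)`:
the index sets `𝓜^+(q,p)`, `𝓜_+(q,p)`, `𝓜^-(q,p)`, `𝓜_-(q,p)` and the two kinds of index sets
(underlined and overlined) for entries `f^p(1/2)`. -/
inductive Kind
  | plusUp
  | plusLow
  | minusUp
  | minusLow
  | halfUnder
  | halfOver

/-- The maps `λ^+ = 1/2 + t/2`, `λ_+ = t/2`, `λ^- = 1 - t/2`, `λ_- = 1/2 - t/2`, and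
the constant map `1/2`. -/
noncomputable def lam : Kind → unitInterval → unitInterval
  | .plusUp, t => ⟨1 / 2 + t / 2, by linarith [t.2.1], by linarith [t.2.2]⟩
  | .plusLow, t => ⟨t / 2, by linarith [t.2.1], by linarith [t.2.2]⟩
  | .minusUp, t => ⟨1 - t / 2, by linarith [t.2.2], by linarith [t.2.1]⟩
  | .minusLow, t => ⟨1 / 2 - t / 2, by linarith [t.2.2], by linarith [t.2.1]⟩
  | .halfUnder, _ => halfPt
  | .halfOver, _ => halfPt

theorem exists_endpt_of_lam (k : Kind) (t : unitInterval) (s : Bool) (h : lam k t = endpt s) :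
    ∃ r, t = endpt r := by
  have h' := congrArg (fun t : unitInterval => (t : ℝ)) h
  have h0 := t.2.1
  have h1 := t.2.2
  suffices hs : (t : ℝ) = 0 ∨ (t : ℝ) = 1 by
    rcases hs with hs | hs
    · exact ⟨false, Subtype.ext hs⟩
    · exact ⟨true, Subtype.ext hs⟩
  cases k <;> cases s <;>
    simp only [lam, endpt, halfPt, Set.Icc.coe_zero, Set.Icc.coe_one] at h' <;>
    first
    | (exfalso; linarith)
    | (left; linarith)
    | (right; linarith)

/-- The block diagonal entries of `φ_F`: the entry `f^p(1/2)` in the summand with index `j_𝔯^p`,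
and for `μ ∈ 𝓜(j,i)` an entry `a^i` in the summand with index `j`. -/
inductive FBlock (A : BuildingBlock) {J : Type} (MF : J → A.I → Type) : Type
  | half (p : A.P) (s : A.Slot p) : FBlock A MF
  | const (i : A.I) (j : J) (μ : MF j i) : FBlock A MF

namespace FBlock

variable {A : BuildingBlock} {J : Type} {MF : J → A.I → Type}

/-- The index set of the matrix entries of a block. -/
def pos : FBlock A MF → Type
  | half p _ => A.Y p
  | const i _ _ => A.X i

/-- The index `j` of the summand `F_{n+1}^j` in which a block is placed. -/
def tgt (jIdx : (Σ p, A.Slot p) → J) : FBlock A MF → J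
  | half p s => jIdx ⟨p, s⟩
  | const _ j _ => j

/-- The value of a block at `(f,a)`. -/
noncomputable def val (x : A.Pairs) : (b : FBlock A MF) → Matrix b.pos b.pos ℂ
  | half p _ => x.1 halfPt p
  | const i _ _ => x.2 i

end FBlock

/-- The block diagonal entries of `φ_C^q` before the last step of the modification: for
`μ` in one of the six index sets of type `k` for `(q,p)` an entry `f^p ∘ λ_μ`, and for
`μ ∈ 𝓜^{q,i}` a constant entry `a^i`. -/
inductive CBlock (A : BuildingBlock) (MC : Kind → A.P → Type) (MCF : A.I → Type) : Type
  | interior (k : Kind) (p : A.P) (μ : MC k p) : CBlock A MC MCF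
  | const (i : A.I) (μ : MCF i) : CBlock A MC MCF

namespace CBlock

variable {A : BuildingBlock} {MC : Kind → A.P → Type} {MCF : A.I → Type}

/-- The index set of the matrix entries of a block. -/
def pos : CBlock A MC MCF → Type
  | interior _ p _ => A.Y p
  | const i _ => A.X i

/-- The value of a block at `(f,a)` and `t ∈ [0,1]`. -/
noncomputable def val (x : A.Pairs) (t : unitInterval) :
    (b : CBlock A MC MCF) → Matrix b.pos b.pos ℂ
  | interior k p _ => x.1 (lam k t) p
  | const i _ => x.2 i

end CBlock

/-! ## Modification (path) -/

/-- The data for one step of modification (path), starting with `A = A_n`. -/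
structure PathData (A : BuildingBlock) where
  /-- The building block obtained in the first step of the modification; its index sets `P` and
  `I` are the index sets for `q` and `j`. -/
  dot : BuildingBlock
  /-- The unital, or the stably projectionless, case takes place at both levels. -/
  unital_iff : A.grave = none ↔ dot.grave = none
  /-- The distinguished index `𝔮` for which `E^𝔮` is enlarged in the second step. -/
  qc : dot.P
  /-- The pairwise distinct indices `j_𝔯^p`. -/
  jIdx : (Σ p, A.Slot p) → dot.I
  jIdx_injective : Function.Injective jIdx
  /-- The sets `𝓜(j,i)`. -/
  MF : dot.I → A.I → Type
  finMF : ∀ j i, Finite (MF j i)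
  /-- The positions of the blocks of `φ_F` in `F_{n+1}`. -/
  embF : ∀ b : FBlock A MF, b.pos → dot.X (b.tgt jIdx)
  embF_injective : Function.Injective
    (fun z : (Σ b : FBlock A MF, b.pos) => (⟨z.1.tgt jIdx, embF z.1 z.2⟩ : Σ j, dot.X j))
  /-- The sets `𝓜^+(q,p)`, `𝓜_+(q,p)`, `𝓜^-(q,p)`, `𝓜_-(q,p)`, and the two sets for the entries
  `f^p(1/2)`. -/
  MC : Kind → dot.P → A.P → Type
  finMC : ∀ k q p, Finite (MC k q p)
  /-- The sets `𝓜^{q,i}`. -/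
  MCF : dot.P → A.I → Type
  finMCF : ∀ q i, Finite (MCF q i)
  /-- The positions of the blocks of `φ_C^q`. -/
  embC : ∀ q, (Σ b : CBlock A (fun k p => MC k q p) (MCF q), b.pos) → dot.Y q
  embC_injective : ∀ q, Function.Injective (embC q)
  /-- All of `m^+(q,p)`, `m_+(q,p)`, `m^-(q,p)`, `m_-(q,p)` are at least one, for all `q`, `p` in
  the unital case and for all `q ≠ q̀`, `p ≠ p̀` in the stably projectionless case. -/
  mult : ∀ q p, dot.grave ≠ some q → A.grave ≠ some p →
    Nonempty (MC .plusUp q p) ∧ Nonempty (MC .plusLow q p) ∧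
      Nonempty (MC .minusUp q p) ∧ Nonempty (MC .minusLow q p)
  /-- In the stably projectionless case, `m^+(q̀,p̀) ≥ 1`, and `m_+(q̀,p̀) ≥ 1` or
  `m_-(q̀,p̀) ≥ 1`. -/
  mult_grave : ∀ q p, dot.grave = some q → A.grave = some p →
    Nonempty (MC .plusUp q p) ∧ (Nonempty (MC .plusLow q p) ∨ Nonempty (MC .minusLow q p))
  /-- If there are indices `p ≠ p̀`, then there are indices `q ≠ q̀`. -/
  exists_ne_grave : ∀ p, A.grave ≠ some p → ∃ q, dot.grave ≠ some q
  /-- An enumeration of `𝓜^i = ∐_j 𝓜(j,i)`. -/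
  num : A.I → ℕ
  enum : ∀ i, Fin (num i) ≃ Σ j, MF j i

namespace PathData

variable {A : BuildingBlock} (S : PathData A)

/-- The embedding of the disjoint union of all the blocks of `φ_F`. -/
def totF (z : Σ b : FBlock A S.MF, b.pos) : Σ j, S.dot.X j := ⟨z.1.tgt S.jIdx, S.embF z.1 z.2⟩

/-- `φ_F : A_n → F_{n+1}`. -/
noncomputable def phiF (x : A.Pairs) : ∀ j, Matrix (S.dot.X j) (S.dot.X j) ℂ :=
  fun j k k' => pushBlocks S.totF (fun b => b.val x) ⟨j, k⟩ ⟨j, k'⟩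

/-- `φ_C` as produced by the first step of the modification. -/
noncomputable def phiC (x : A.Pairs) (t : unitInterval) :
    ∀ q, Matrix (S.dot.Y q) (S.dot.Y q) ℂ :=
  fun q => pushBlocks (S.embC q) (fun b => b.val x t)

/-- The connecting map produced by the first step of the modification. -/
noncomputable def phiDot (x : A.Pairs) : S.dot.Pairs := (S.phiC x, S.phiF x)

/-- The cyclic permutation of `𝓜^i = ∐_j 𝓜(j,i)` sending `μ_l` to `μ_{l+1}`. -/
def cyc (i : A.I) : Equiv.Perm (Σ j, S.MF j i) := (S.enum i).permCongr (finRotate (S.num i))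

theorem const_congr {i : A.I} {z z' : Σ j, S.MF j i} (h : z = z') (u : A.X i) :
    (⟨.const i z.1 z.2, u⟩ : Σ b : FBlock A S.MF, b.pos) = ⟨.const i z'.1 z'.2, u⟩ := by
  subst h; rfl

theorem half_congr {p : A.P} {s s' : A.Slot p} (h : s = s') (u : A.Y p) :
    (⟨.half p s, u⟩ : Σ b : FBlock A S.MF, b.pos) = ⟨.half p s', u⟩ := by
  subst h; rfl

/-- The permutation of the positions in the blocks of `φ_F` that underlies `w`: it
exchanges the two copies of `E_n^p` for `p ≠ p̀`, fixes the copy of `E_n^p̀`, and moves the copies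
of `F_n^i` cyclically. -/
noncomputable def labelPerm : Equiv.Perm (Σ b : FBlock A S.MF, b.pos) where
  toFun
    | ⟨.half p s, u⟩ => ⟨.half p (A.flip p s), u⟩
    | ⟨.const i j μ, u⟩ => ⟨.const i (S.cyc i ⟨j, μ⟩).1 (S.cyc i ⟨j, μ⟩).2, u⟩
  invFun
    | ⟨.half p s, u⟩ => ⟨.half p ((A.flip p).symm s), u⟩
    | ⟨.const i j μ, u⟩ => ⟨.const i ((S.cyc i).symm ⟨j, μ⟩).1 ((S.cyc i).symm ⟨j, μ⟩).2, u⟩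
  left_inv := by
    rintro ⟨⟨p, s⟩ | ⟨i, j, μ⟩, u⟩
    · exact S.half_congr ((A.flip p).symm_apply_apply s) u
    · exact S.const_congr ((S.cyc i).symm_apply_apply ⟨j, μ⟩) u
  right_inv := by
    rintro ⟨⟨p, s⟩ | ⟨i, j, μ⟩, u⟩
    · exact S.half_congr ((A.flip p).apply_symm_apply s) u
    · exact S.const_congr ((S.cyc i).apply_symm_apply ⟨j, μ⟩) u

open Classical in
/-- The permutation matrix `w`, as a permutation of the positions in `F_{n+1}`; it fixes all
positions outside of the blocks of `φ_F`. -/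
noncomputable def w : Equiv.Perm (Σ j, S.dot.X j) :=
  S.labelPerm.extendDomain (Equiv.ofInjective S.totF S.embF_injective)

/-- The embedding for `β_{n+1,𝔯}^q`.  The new summand for `q = 𝔮` is the identity of `F_{n+1}` for
`𝔯 = 0`, and `Ad(w)` of it for `𝔯 = 1`. -/
noncomputable def nextEmb (r : Bool) (q : S.dot.P) :
    (Σ b : (Σ j, S.dot.M r q j ⊕ PLift (q = S.qc)), S.dot.X b.1) →
      S.dot.Y q ⊕ {_x : Σ j, S.dot.X j // q = S.qc}
  | ⟨⟨j, .inl μ⟩, x⟩ => .inl (S.dot.emb r q ⟨⟨j, μ⟩, x⟩)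
  | ⟨⟨j, .inr h⟩, x⟩ => .inr ⟨if r then S.w ⟨j, x⟩ else ⟨j, x⟩, h.down⟩

theorem nextEmb_injective (r : Bool) (q : S.dot.P) : Function.Injective (S.nextEmb r q) := by
  rintro ⟨⟨j, μ | h⟩, x⟩ ⟨⟨j', μ' | h'⟩, x'⟩ he
  · have := S.dot.emb_injective r q (Sum.inl.inj he)
    simp only [Sigma.mk.injEq] at this
    obtain ⟨⟨rfl, h1⟩, h2⟩ := this
    cases h1; cases h2; rfl
  · simp [nextEmb] at he
  · simp [nextEmb] at he
  · have h1 := congrArg Subtype.val (Sum.inr.inj he)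
    have h2 : (⟨j, x⟩ : Σ j, S.dot.X j) = ⟨j', x'⟩ := by
      cases r
      · simpa using h1
      · simpa using h1
    cases h; cases h'; cases h2; rfl

theorem nextEmb_surjective (r : Bool) (q : S.dot.P) :
    Function.Surjective (S.nextEmb r q) ↔ Function.Surjective (S.dot.emb r q) := by
  constructor
  · intro h y
    obtain ⟨⟨⟨j, μ | h'⟩, x⟩, hz⟩ := h (Sum.inl y)
    · exact ⟨⟨⟨j, μ⟩, x⟩, Sum.inl.inj hz⟩
    · simp [nextEmb] at hz
  · rintro h (y | ⟨y, hq⟩)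
    · obtain ⟨⟨⟨j, μ⟩, x⟩, hz⟩ := h y
      exact ⟨⟨⟨j, .inl μ⟩, x⟩, congrArg Sum.inl hz⟩
    · cases r
      · exact ⟨⟨⟨y.1, .inr ⟨hq⟩⟩, y.2⟩, by simp [nextEmb]⟩
      · exact ⟨⟨⟨(S.w.symm y).1, .inr ⟨hq⟩⟩, (S.w.symm y).2⟩, by simp [nextEmb]⟩

/-- The building block `A_{n+1}`: `E_{n+1}^𝔮` has the additional positions `∐_j X_{n+1}^j`. -/
noncomputable def next : BuildingBlock where
  P := S.dot.P
  I := S.dot.I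
  Y := fun q => S.dot.Y q ⊕ {_x : Σ j, S.dot.X j // q = S.qc}
  X := S.dot.X
  M := fun r q j => S.dot.M r q j ⊕ PLift (q = S.qc)
  finP := S.dot.finP
  finI := S.dot.finI
  finY := fun q => by
    have := S.dot.finY q
    have := S.dot.finI
    have := S.dot.finX
    infer_instance
  finX := S.dot.finX
  finM := fun r q j => by
    have := S.dot.finM r q j
    infer_instance
  emb := S.nextEmb
  emb_injective := S.nextEmb_injective
  grave := S.dot.grave
  unital_zero := fun q => (S.nextEmb_surjective false q).2 (S.dot.unital_zero q)
  unital_one := fun q => (S.nextEmb_surjective true q).trans (S.dot.unital_one q)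

end PathData

/-- One step of modification (path): data as above for which the first step of the modification
yields a well-defined map into the one-dimensional NCCW complex given by `dot`. -/
structure PathStep (A : BuildingBlock) extends PathData A where
  wellDefined : ∀ x ∈ A.alg, toPathData.phiDot x ∈ dot.alg

/-! ## The subgroupoid `H_n` and the map `𝒑` -/

/-- The components of `𝓔_{n+1}^q[𝒑]`: those coming from the block diagonal entries of `φ_C^q` in the
first step and, for `q = 𝔮`, the additional copy of `𝓕_{n+1}[𝒑]`. -/
inductive HBlock {A : BuildingBlock} (S : PathData A) (q : S.dot.P) : Type
  | ofC (b : CBlock A (fun k p => S.MC k q p) (S.MCF q)) : HBlock S q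
  | extra (h : q = S.qc) (b : FBlock A S.MF) : HBlock S q

/-- The index set of the matrix entries of a block. -/
def HBlock.pos {A : BuildingBlock} {S : PathData A} {q : S.dot.P} : HBlock S q → Type
  | .ofC b => b.pos
  | .extra _ b => b.pos

/-- The position in `E_{n+1}^q` of an entry of a block. -/
def HBlock.place {A : BuildingBlock} {S : PathData A} {q : S.dot.P} :
    (b : HBlock S q) → b.pos → S.next.Y q
  | .ofC b, u => Sum.inl (S.embC q ⟨b, u⟩)
  | .extra h b, u => Sum.inr ⟨S.totF ⟨b, u⟩, h⟩

namespace PathStep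

variable {A : BuildingBlock} (S : PathStep A)

/-- The building block `A_{n+1}`. -/
noncomputable abbrev next : BuildingBlock := S.toPathData.next

/-- `𝓔_{n+1}[𝒑]`: pairs `(μ,γ)`, where `μ` labels a block and `γ` belongs to `𝓔_n^p`, `𝓕_n^i`. -/
def EH : Type := Σ q, Σ b : HBlock S.toPathData q, b.pos × b.pos

/-- `𝓕_{n+1}[𝒑]`. -/
def FH : Type := Σ b : FBlock A S.MF, b.pos × b.pos

instance : TopologicalSpace S.EH := ⊥
instance : TopologicalSpace S.FH := ⊥
instance : DiscreteTopology S.EH := ⟨rfl⟩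
instance : DiscreteTopology S.FH := ⟨rfl⟩

/-- The inclusion `𝓔_{n+1}[𝒑] ⊆ 𝓔_{n+1}`. -/
noncomputable def inclE (η : S.EH) : S.next.E :=
  ⟨η.1, η.2.1.place η.2.2.1, η.2.1.place η.2.2.2⟩

/-- The inclusion `𝓕_{n+1}[𝒑] ⊆ 𝓕_{n+1}`. -/
noncomputable def inclF (ζ : S.FH) : S.next.F :=
  ⟨ζ.1.tgt S.jIdx, S.embF ζ.1 ζ.2.1, S.embF ζ.1 ζ.2.2⟩

/-- `𝓔_{n+1,𝔯}[𝒑]`: for `(μ,γ)` with `γ ∈ 𝓔_n^p` it is required that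
`γ ∈ 𝓔_{n,λ_μ(𝔯)}` if `λ_μ(𝔯) ∈ {0,1}`. -/
def domH (r : Bool) : Set S.EH :=
  {η | match η with
    | ⟨_, .ofC (.interior k p _), u⟩ => A.Adm (lam k (endpt r)) (⟨p, u⟩ : Σ p, A.Y p × A.Y p)
    | ⟨_, .ofC (.const _ _), _⟩ => True
    | ⟨_, .extra _ _, _⟩ => True}

/-- `(t,η)` belongs to `[0,1] ×_• 𝓔_{n+1}[𝒑]`. -/
def AdmH (t : unitInterval) (η : S.EH) : Prop := ∀ r, t = endpt r → η ∈ S.domH r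

/-- `([0,1] ×_• 𝓔_{n+1}[𝒑]) ∐ 𝓕_{n+1}[𝒑]`. -/
abbrev PreH : Type := {x : unitInterval × S.EH // S.AdmH x.1 x.2} ⊕ S.FH

/-- The identifications `(𝔯,η) ∼ 𝒃_𝔯(η)` for `η ∈ 𝓔_{n+1,𝔯}[𝒑]`. -/
inductive GlueH : S.PreH → S.PreH → Prop
  | mk (r : Bool) (η : S.EH) (h : S.AdmH (endpt r) η) (ζ : S.FH)
      (hb : S.next.bGraph r (S.inclE η) (S.inclF ζ)) :
      GlueH (Sum.inl ⟨(endpt r, η), h⟩) (Sum.inr ζ)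

/-- The space of `H_n = (([0,1] ×_• 𝓔_{n+1}[𝒑]) ∐ 𝓕_{n+1}[𝒑]) / ∼`. -/
def H : Type := Quot S.GlueH

instance : TopologicalSpace S.H := inferInstanceAs (TopologicalSpace (Quot S.GlueH))

/-- The class `[t,η]` in `H_n`. -/
def edgeH (t : unitInterval) (η : S.EH) (h : S.AdmH t η) : S.H := Quot.mk _ (Sum.inl ⟨(t, η), h⟩)

/-- The class of `ζ ∈ 𝓕_{n+1}[𝒑]` in `H_n`. -/
def vertexH (ζ : S.FH) : S.H := Quot.mk _ (Sum.inr ζ)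

theorem adm_halfPt (γ : A.E) : A.Adm halfPt γ := by
  intro r h
  have h' := congrArg (fun t : unitInterval => (t : ℝ)) h
  cases r <;> norm_num [halfPt, endpt] at h'

theorem adm_lam {q : S.dot.P} {k : Kind} {p : A.P} {μ : S.MC k q p} {u : A.Y p × A.Y p}
    {t : unitInterval} (h : S.AdmH t ⟨q, .ofC (.interior k p μ), u⟩) :
    A.Adm (lam k t) (⟨p, u⟩ : Σ p, A.Y p × A.Y p) := by
  intro s hs
  obtain ⟨r, rfl⟩ := exists_endpt_of_lam k t s hs
  exact h r rfl s hs

/-- `𝒑` on `𝓕_{n+1}[𝒑]`: `𝒑(μ,γ) = γ` for `γ ∈ 𝓕_n^i`, and `𝒑(γ) = [1/2,γ]` for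
`γ ∈ 𝓔_n^p ⊆ 𝓕_{n+1}^j`, `j = j_𝔯^p`. -/
noncomputable def pF : S.FH → A.G
  | ⟨.half p _, u⟩ => A.edge halfPt (⟨p, u⟩ : Σ p, A.Y p × A.Y p) (adm_halfPt _)
  | ⟨.const i _ _, u⟩ => A.vertex (⟨i, u⟩ : Σ i, A.X i × A.X i)

/-- `𝒑` on `[0,1] ×_• 𝓔_{n+1}[𝒑]`: `𝒑[t,(μ,γ)] = [λ_μ(t),γ]` for `γ ∈ 𝓔_n^p`,
`𝒑[t,(μ,γ)] = γ` for `γ ∈ 𝓕_n^i`, and `𝒑[t,γ] = 𝒑(γ)` on the additional copy of `𝓕_{n+1}[𝒑]`. -/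
noncomputable def pE (t : unitInterval) : (η : S.EH) → S.AdmH t η → A.G
  | ⟨_, .ofC (.interior k p _), u⟩, h => A.edge (lam k t) (⟨p, u⟩ : Σ p, A.Y p × A.Y p) (S.adm_lam h)
  | ⟨_, .ofC (.const i _), u⟩, _ => A.vertex (⟨i, u⟩ : Σ i, A.X i × A.X i)
  | ⟨_, .extra _ b, u⟩, _ => S.pF ⟨b, u⟩

/-! Both inclusions are compatible with the `𝒃_𝔯`, and `𝒑` is well-defined. -/

theorem phiF_inclF (x : A.Pairs) (ζ : S.FH) :
    S.phiF x _ (S.inclF ζ).2.1 (S.inclF ζ).2.2 = ζ.1.val x ζ.2.1 ζ.2.2 :=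
  pushBlocks_apply S.embF_injective (fun b => b.val x) ζ.1 ζ.2.1 ζ.2.2

theorem ev_pF (x : A.Pairs) (hx : x ∈ A.alg) (ζ : S.FH) :
    A.ev x hx (S.pF ζ) = S.phiF x _ (S.inclF ζ).2.1 (S.inclF ζ).2.2 := by
  rw [phiF_inclF]
  rcases ζ with ⟨_ | _, u⟩ <;> rfl

theorem val_labelPerm_symm (b : FBlock A S.MF) : ∃ b' : FBlock A S.MF,
    ∃ f : b.pos → b'.pos, (∀ u, S.labelPerm.symm ⟨b, u⟩ = ⟨b', f u⟩) ∧
      ∀ x : A.Pairs, ∀ u u', b'.val x (f u) (f u') = b.val x u u' := by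
  rcases b with ⟨p, s⟩ | ⟨i, j, μ⟩
  · exact ⟨.half p ((A.flip p).symm s), id, fun _ => rfl, fun _ _ _ => rfl⟩
  · exact ⟨.const i ((S.cyc i).symm ⟨j, μ⟩).1 ((S.cyc i).symm ⟨j, μ⟩).2, id, fun _ => rfl,
      fun _ _ _ => rfl⟩

theorem w_totF (z : Σ b : FBlock A S.MF, b.pos) : S.w (S.totF z) = S.totF (S.labelPerm z) := by
  classical
  exact Equiv.Perm.extendDomain_apply_image S.labelPerm
    (Equiv.ofInjective S.totF S.embF_injective) z

/-- On the additional copy of `𝓕_{n+1}[𝒑]`, the map `𝒃_𝔯` takes values in `𝓕_{n+1}[𝒑]`. -/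
theorem extra_bGraph (r : Bool) (q : S.dot.P) (h : q = S.qc) (b : FBlock A S.MF)
    (u : b.pos × b.pos) :
    ∃ ζ : S.FH, S.next.bGraph r (S.inclE ⟨q, .extra h b, u⟩) (S.inclF ζ) := by
  cases r
  · exact ⟨⟨b, u⟩, Sum.inr ⟨h⟩, rfl, rfl⟩
  · obtain ⟨b', f, hf, -⟩ := S.val_labelPerm_symm b
    have key : ∀ v, S.w (S.totF ⟨b', f v⟩) = S.totF ⟨b, v⟩ := fun v => by
      rw [w_totF, ← hf, Equiv.apply_symm_apply]
    exact ⟨⟨b', f u.1, f u.2⟩, Sum.inr ⟨h⟩, congrArg Sum.inr (Subtype.ext (key u.1)),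
      congrArg Sum.inr (Subtype.ext (key u.2))⟩

theorem bGraph_unique (B : BuildingBlock) {r : Bool} {γ : B.E} {η η' : B.F} (h : B.bGraph r γ η)
    (h' : B.bGraph r γ η') : η = η' := by
  obtain ⟨μ, h1, h2⟩ := h
  obtain ⟨μ', h1', h2'⟩ := h'
  obtain ⟨i, x, y⟩ := η
  obtain ⟨i', x', y'⟩ := η'
  have e1 := B.emb_injective r γ.1 (h1.trans h1'.symm)
  have e2 := B.emb_injective r γ.1 (h2.trans h2'.symm)
  cases e1
  cases e2
  rfl

theorem ev_pE (x : A.Pairs) (hx : x ∈ A.alg) (r : Bool) (η : S.EH) (h : S.AdmH (endpt r) η)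
    (ζ : S.next.F) (hb : S.next.bGraph r (S.inclE η) ζ) :
    A.ev x hx (S.pE (endpt r) η h) = S.phiF x ζ.1 ζ.2.1 ζ.2.2 := by
  rcases η with ⟨q, b | ⟨hq, b⟩, u⟩
  · have hw : S.phiC x (endpt r) q = S.dot.beta r (S.phiF x) q :=
      congrFun ((S.wellDefined x hx).2 r) q
    have h1 : A.ev x hx (S.pE (endpt r) ⟨q, .ofC b, u⟩ h) = b.val x (endpt r) u.1 u.2 := by
      rcases b with _ | _ <;> rfl
    have h2 : S.phiC x (endpt r) q (S.embC q ⟨b, u.1⟩) (S.embC q ⟨b, u.2⟩) =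
        b.val x (endpt r) u.1 u.2 :=
      pushBlocks_apply (S.embC_injective q) (fun b => b.val x (endpt r)) b u.1 u.2
    rw [h1, ← h2, hw]
    obtain ⟨μ | μ, e1, e2⟩ := hb
    · have e1' : S.dot.emb r q ⟨⟨ζ.1, μ⟩, ζ.2.1⟩ = S.embC q ⟨b, u.1⟩ := Sum.inl.inj e1
      have e2' : S.dot.emb r q ⟨⟨ζ.1, μ⟩, ζ.2.2⟩ = S.embC q ⟨b, u.2⟩ := Sum.inl.inj e2
      rw [← e1', ← e2']
      exact pushBlocks_apply (X := fun b : (Σ j, S.dot.M r q j) => S.dot.X b.1)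
        (S.dot.emb_injective r q) (fun b => S.phiF x b.1) ⟨ζ.1, μ⟩ _ _
    · exact absurd e1 Sum.inr_ne_inl
  · refine (S.ev_pF x hx (⟨b, u⟩ : Σ b : FBlock A S.MF, b.pos × b.pos)).trans ?_
    cases r
    · have : S.next.bGraph false (S.inclE ⟨q, .extra hq b, u⟩) (S.inclF ⟨b, u⟩) :=
        ⟨Sum.inr ⟨hq⟩, rfl, rfl⟩
      rw [bGraph_unique _ hb this]
    · obtain ⟨b', f, hf, hv⟩ := S.val_labelPerm_symm b
      have key : ∀ v, S.w (S.totF ⟨b', f v⟩) = S.totF ⟨b, v⟩ := fun v => by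
        rw [w_totF, ← hf, Equiv.apply_symm_apply]
      have : S.next.bGraph true (S.inclE ⟨q, .extra hq b, u⟩) (S.inclF ⟨b', f u.1, f u.2⟩) :=
        ⟨Sum.inr ⟨hq⟩, congrArg Sum.inr (Subtype.ext (key u.1)),
          congrArg Sum.inr (Subtype.ext (key u.2))⟩
      rw [bGraph_unique _ hb this]
      exact (S.phiF_inclF x (⟨b, u⟩ : Σ b : FBlock A S.MF, b.pos × b.pos)).trans
        ((hv x u.1 u.2).symm.trans (S.phiF_inclF x ⟨b', f u.1, f u.2⟩).symm)

/-- `𝓔_{n+1,𝔯}[𝒑] ⊆ 𝓔_{n+1,𝔯}`, and `𝒃_𝔯` maps `𝓔_{n+1,𝔯}[𝒑]` to `𝓕_{n+1}[𝒑]`. -/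
theorem exists_bGraph (r : Bool) (η : S.EH) (h : S.AdmH (endpt r) η) :
    ∃ ζ : S.FH, S.next.bGraph r (S.inclE η) (S.inclF ζ) := by
  obtain ⟨x, hx, hne⟩ := A.exists_ev_ne_zero (S.pE (endpt r) η h)
  rcases η with ⟨q, b | ⟨hq, b⟩, u⟩
  · have hw : S.phiC x (endpt r) q = S.dot.beta r (S.phiF x) q :=
      congrFun ((S.wellDefined x hx).2 r) q
    have h1 : A.ev x hx (S.pE (endpt r) ⟨q, .ofC b, u⟩ h) = b.val x (endpt r) u.1 u.2 := by
      rcases b with _ | _ <;> rfl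
    have h2 : S.phiC x (endpt r) q (S.embC q ⟨b, u.1⟩) (S.embC q ⟨b, u.2⟩) =
        b.val x (endpt r) u.1 u.2 :=
      pushBlocks_apply (S.embC_injective q) (fun b => b.val x (endpt r)) b u.1 u.2
    rw [h1, ← h2, hw] at hne
    obtain ⟨⟨j, μ⟩, k, k', e1, e2⟩ := exists_of_pushBlocks_ne_zero _ _ _ hne
    have h3 := pushBlocks_apply (X := fun b : (Σ j, S.dot.M r q j) => S.dot.X b.1)
        (S.dot.emb_injective r q) (fun b => S.phiF x b.1) ⟨j, μ⟩ k k'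
    rw [e1, e2] at h3
    have h4 : S.phiF x j k k' ≠ 0 := fun h0 => hne (h3.trans h0)
    obtain ⟨b', v, v', f1, f2⟩ := exists_of_pushBlocks_ne_zero _ _ _ h4
    cases f1
    cases f2
    exact ⟨⟨b', v, v'⟩, Sum.inl μ, congrArg Sum.inl e1, congrArg Sum.inl e2⟩
  · exact S.extra_bGraph r q hq b u

theorem adm_inclE {t : unitInterval} {η : S.EH} (h : S.AdmH t η) : S.next.Adm t (S.inclE η) := by
  rintro r rfl
  obtain ⟨ζ, hζ⟩ := S.exists_bGraph r η h
  exact ⟨_, hζ⟩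

/-- The inclusion `H_n ⊆ G_{n+1}`. -/
noncomputable def incl : S.H → S.next.G :=
  Quot.lift
    (fun z => match z with
      | .inl z => S.next.edge z.1.1 (S.inclE z.1.2) (S.adm_inclE z.2)
      | .inr ζ => S.next.vertex (S.inclF ζ))
    (by
      rintro _ _ ⟨r, η, h, ζ, hb⟩
      exact S.next.edge_eq_vertex _ hb)

/-- The map `𝒑 : H_n → G_n`. -/
noncomputable def p : S.H → A.G :=
  Quot.lift
    (fun z => match z with
      | .inl z => S.pE z.1.1 z.1.2 z.2
      | .inr ζ => S.pF ζ)
    (by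
      rintro _ _ ⟨r, η, h, ζ, hb⟩
      refine A.eq_of_ev_eq fun x hx => ?_
      exact (S.ev_pE x hx r η h _ hb).trans (S.ev_pF x hx ζ).symm)

end PathStep

/-! ## Paths of piecewise form -/

/-- `w` is a stop value of `ω` on `s`: the function `ω` takes the constant value `w` on some closed
subinterval of `s` with positive length. -/
def IsStopValue (ω : unitInterval → unitInterval) (s : Set unitInterval) (w : unitInterval) : Prop :=
  ∃ a b, a < b ∧ Set.Icc a b ⊆ s ∧ ∀ t ∈ Set.Icc a b, ω t = w

/-- `w ∈ ℤ[1/2]`. -/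
def IsDyadic (w : unitInterval) : Prop := ∃ (m : ℤ) (k : ℕ), (w : ℝ) = m / 2 ^ k

/-- The set `{0, 1/2, 1}`. -/
noncomputable def special : Set unitInterval := {0, halfPt, 1}

/-- A presentation of the path `ξ` in the groupoid model: points
`0 = 𝔱_0 < 𝔱_1 < … < 𝔱_{D+1} = 1` and, for every `0 ≤ d ≤ D`, an element `γ_d ∈ 𝓔` and a
continuous, monotonous function `ω_d : [𝔱_d,𝔱_{d+1}] → [0,1]` such that
`ξ(t) = [ω_d(t),γ_d]` for all `t ∈ [𝔱_d,𝔱_{d+1}]`. (The values of `ω_d` at other points play no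
role.) -/
structure PathForm (B : BuildingBlock) (ξ : unitInterval → B.G) where
  D : ℕ
  τ : Fin (D + 2) → unitInterval
  τ_strictMono : StrictMono τ
  τ_zero : τ 0 = 0
  τ_last : τ (Fin.last (D + 1)) = 1
  γ : Fin (D + 1) → B.E
  ω : Fin (D + 1) → unitInterval → unitInterval
  continuousOn : ∀ d, ContinuousOn (ω d) (Set.Icc (τ d.castSucc) (τ d.succ))
  monotone : ∀ d, MonotoneOn (ω d) (Set.Icc (τ d.castSucc) (τ d.succ)) ∨
    AntitoneOn (ω d) (Set.Icc (τ d.castSucc) (τ d.succ))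
  adm : ∀ d, ∀ t ∈ Set.Icc (τ d.castSucc) (τ d.succ), B.Adm (ω d t) (γ d)
  eq_edge : ∀ d t (ht : t ∈ Set.Icc (τ d.castSucc) (τ d.succ)),
    ξ t = B.edge (ω d t) (γ d) (adm d t ht)

namespace PathForm

variable {B : BuildingBlock} {ξ : unitInterval → B.G} (X : PathForm B ξ)

/-- The interval `[𝔱_d,𝔱_{d+1}]`. -/
def intv (d : Fin (X.D + 1)) : Set unitInterval := Set.Icc (X.τ d.castSucc) (X.τ d.succ)

/-- The set of stop values of `ω_d`. -/
def stopValues (d : Fin (X.D + 1)) : Set unitInterval := {w | IsStopValue (X.ω d) (X.intv d) w}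

/-- `ω_d([𝔱_d,𝔱_{d+1}]) ∩ ℤ[1/2]`. -/
def dyadicValues (d : Fin (X.D + 1)) : Set unitInterval := {w | w ∈ X.ω d '' X.intv d ∧ IsDyadic w}

/-- The index of the first interval for `𝔯 = 0` and of the last interval for `𝔯 = 1`. -/
def endIdx : Bool → Fin (X.D + 1)
  | false => 0
  | true => Fin.last X.D

/-- `ω_0(0)` for `𝔯 = 0` and `ω_D(1)` for `𝔯 = 1`. -/
def endValue (r : Bool) : unitInterval := X.ω (X.endIdx r) (endpt r)

/-- Property (P1), with an exception for the endpoints in `exc`: the set of stop values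
of `ω_d` is `ω_d([𝔱_d,𝔱_{d+1}]) ∩ ℤ[1/2]`, except for `ω_0(0)` (if `0 ∈ exc` and `d = 0`)
and for `ω_D(1)` (if `1 ∈ exc` and `d = D`), which are not stop values. The property (P1) itself is
the case `exc = ∅`. -/
def P1 (exc : Set Bool) : Prop :=
  ∀ d, X.stopValues d = X.dyadicValues d \ {w | ∃ r ∈ exc, d = X.endIdx r ∧ w = X.endValue r}

/-- Property (P2): some `ω_d` has a stop value in `{0, 1/2, 1}`. -/
def P2 : Prop := ∃ d, ∃ t ∈ X.intv d, X.ω d t ∈ special ∧ X.ω d t ∈ X.stopValues d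

/-- Property (P3a) at the endpoint `𝔯`: the value of `ω` at `𝔯` belongs to `{0,1}` and is not a stop
value. -/
def P3a (r : Bool) : Prop :=
  X.endValue r ∈ ({0, 1} : Set unitInterval) ∧ X.endValue r ∉ X.stopValues (X.endIdx r)

/-- The set of all `t` such that `t ∈ [𝔱_d,𝔱_{d+1}]` and `ω_d(t) ∈ {0,1/2,1}` for some `d`. -/
def specialTimes : Set unitInterval := {t | ∃ d, t ∈ X.intv d ∧ X.ω d t ∈ special}

/-- `𝔱` is the first time in `(0,1]` (for `𝔯 = 0`), respectively the last time in `[0,1)` (for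
`𝔯 = 1`), with `ω_d(𝔱) ∈ {0,1/2,1}` for some `d`. -/
def IsFirstSpecial : Bool → unitInterval → Prop
  | false, t₀ => IsLeast {t | t ∈ X.specialTimes ∧ 0 < t} t₀
  | true, t₀ => IsGreatest {t | t ∈ X.specialTimes ∧ t < 1} t₀

/-- For all `d` such that `[𝔱_d,𝔱_{d+1}]` meets the segment between the endpoint `𝔯` and `t₀` in
more than possibly the point `t₀`, the values of `ω_d` on the intersection belong to `R`. -/
def ValuesIn (R : Set unitInterval) : Bool → unitInterval → Prop
  | false, t₀ => ∀ d, X.τ d.castSucc < t₀ → ∀ t ∈ X.intv d, t ≤ t₀ → X.ω d t ∈ R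
  | true, t₀ => ∀ d, t₀ < X.τ d.succ → ∀ t ∈ X.intv d, t₀ ≤ t → X.ω d t ∈ R

/-- Property (P3b) at the endpoint `𝔯` for a point `h` of `H_n`: the point `h` is of the form
`[w,(μ,γ)]` with `w ∈ {0,1}`, where `γ = γ_0` for `𝔯 = 0` and `γ = γ_D` for `𝔯 = 1`, and the values
of `ω` between the endpoint `𝔯` and the first time at which `ω` takes a value in `{0,1/2,1}` again
belong to the image of `λ_μ`. -/
def P3b {A : BuildingBlock} (S : PathStep A) {ξ : unitInterval → A.G} (X : PathForm A ξ) (r : Bool)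
    (h : S.H) : Prop :=
  ∃ (w : Bool) (q : S.dot.P) (k : Kind) (p : A.P) (μ : S.MC k q p) (u : A.Y p × A.Y p)
    (hadm : S.AdmH (endpt w) ⟨q, .ofC (.interior k p μ), u⟩),
    h = S.edgeH (endpt w) ⟨q, .ofC (.interior k p μ), u⟩ hadm ∧
    (⟨p, u⟩ : Σ p, A.Y p × A.Y p) = X.γ (X.endIdx r) ∧
    ∃ t₀, X.IsFirstSpecial r t₀ ∧ X.ValuesIn (Set.range (lam k)) r t₀

end PathForm

/-! A stretch of the path on which `ω` stays in `[0,1/2]` or in `[1/2,1]` lifts along a single edge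
of `H_n`: a nonconstant `λ_μ` is a homeomorphism onto one of the two halves, so the lift is the
inverse of `λ_μ` composed with `ω` (`exists_lifts_interior`). Positivity of the multiplicities
provides such a `μ` for every `p` and both halves (`exists_interior`). What remains is to pass from
one edge of `H_n` to another over the same point, and the stops give the time for this.

Over a point `[v,γ]` with `v ∈ {0,1/2,1}` the fibre of `𝒑` is path connected
(`fibreConn_of_special`). Each of its points is a vertex or lies on an edge on which `𝒑` is
constant, and such an edge can be followed to a vertex. Two vertices of the same fibre are joined
through the additional copy of `𝓕_{n+1}[𝒑]` in `𝓔^𝔮`: its ends are glued by the identity and by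
`Ad(w)`, and `w` exchanges the two copies of `E_n^p` and permutes the copies of `F_n^i` in one
cycle. Since `0`, `1/2`, `1` are dyadic, `ω` stops whenever it meets them, except at the exceptional
ends; there (P3b) ensures that the prescribed point already lies on an edge along which the lift can
start.

This lifts a path with one prescribed end (`exists_lifts_of_chain` and its time reversal). To
prescribe both, the path is cut at the stop given by (P2). The first part is lifted forwards, the
second backwards, and the two loose ends, which lie in one connected fibre, are joined during the
stop. The connection is led through a vertex, which yields (P2) for the lift.

For (P1), `λ_μ` and its inverse preserve dyadic numbers, so stops are transported along edges.
Motion inside a fibre needs functions which stop exactly at the dyadic numbers; these come from the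
generalized inverse of a strictly increasing function that jumps exactly there (`exists_isStair`).
-/

/-! ## Staircase functions -/

open Set unitInterval Filter Topology

/-- A strictly increasing function on `[0,1]` whose jumps are exactly at the dyadic numbers. -/
noncomputable def dyadicJump (x : ℝ) : ℝ := x + ∑' k : ℕ, (1 / 4 : ℝ) ^ k * ⌈(2 : ℝ) ^ k * x⌉

theorem dyadicJump_term_bound {x : ℝ} (hx : x ∈ Icc (0 : ℝ) 1) (k : ℕ) :
    0 ≤ (1 / 4 : ℝ) ^ k * ⌈(2 : ℝ) ^ k * x⌉ ∧
      (1 / 4 : ℝ) ^ k * ⌈(2 : ℝ) ^ k * x⌉ ≤ (1 / 2 : ℝ) ^ k := by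
  have h2 : (0 : ℝ) < 2 ^ k := by positivity
  have h0 : (0 : ℝ) ≤ ⌈(2 : ℝ) ^ k * x⌉ := by
    exact_mod_cast Int.ceil_nonneg (mul_nonneg h2.le hx.1)
  have h1 : (⌈(2 : ℝ) ^ k * x⌉ : ℝ) ≤ 2 ^ k := by
    have : ⌈(2 : ℝ) ^ k * x⌉ ≤ (2 ^ k : ℤ) := by
      rw [Int.ceil_le]
      push_cast
      nlinarith [hx.2]
    exact_mod_cast this
  refine ⟨by positivity, ?_⟩
  calc (1 / 4 : ℝ) ^ k * ⌈(2 : ℝ) ^ k * x⌉ ≤ (1 / 4 : ℝ) ^ k * 2 ^ k := by gcongr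
    _ = (1 / 2 : ℝ) ^ k := by rw [← mul_pow]; norm_num

theorem summable_dyadicJump {x : ℝ} (hx : x ∈ Icc (0 : ℝ) 1) :
    Summable fun k : ℕ => (1 / 4 : ℝ) ^ k * ⌈(2 : ℝ) ^ k * x⌉ :=
  Summable.of_nonneg_of_le (fun k => (dyadicJump_term_bound hx k).1)
    (fun k => (dyadicJump_term_bound hx k).2)
    (summable_geometric_of_lt_one (by norm_num) (by norm_num))

theorem dyadicJump_lt {x x' : ℝ} (hx : x ∈ Icc (0 : ℝ) 1) (hx' : x' ∈ Icc (0 : ℝ) 1) (h : x < x') :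
    dyadicJump x < dyadicJump x' := by
  refine add_lt_add_of_lt_of_le h
    ((summable_dyadicJump hx).tsum_le_tsum (fun k => ?_) (summable_dyadicJump hx'))
  gcongr

/-- At `x = m / 2 ^ k` the number `2 ^ k * x` is an integer, so the `k`-th ceiling grows by at least
one immediately to the right of `x`; the other terms do not decrease. -/
theorem dyadicJump_add_lt {x x' : ℝ} (hx : x ∈ Icc (0 : ℝ) 1) (hx' : x' ∈ Icc (0 : ℝ) 1)
    (h : x < x') {m : ℤ} {k : ℕ} (hm : x = m / 2 ^ k) :
    dyadicJump x + (1 / 4) ^ k < dyadicJump x' := by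
  have hle : (1 / 4 : ℝ) ^ k ≤ ∑' l : ℕ, ((1 / 4 : ℝ) ^ l * ⌈(2 : ℝ) ^ l * x'⌉ -
      (1 / 4 : ℝ) ^ l * ⌈(2 : ℝ) ^ l * x⌉) := by
    refine le_trans ?_ (((summable_dyadicJump hx').sub (summable_dyadicJump hx)).le_tsum k ?_)
    · have h1 : ⌈(2 : ℝ) ^ k * x⌉ + 1 ≤ ⌈(2 : ℝ) ^ k * x'⌉ := by
        have e : (2 : ℝ) ^ k * x = m := by rw [hm]; field_simp
        rw [e, Int.ceil_intCast, Int.add_one_le_iff, Int.lt_ceil, ← e]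
        gcongr
      have h2 : (⌈(2 : ℝ) ^ k * x⌉ : ℝ) + 1 ≤ ⌈(2 : ℝ) ^ k * x'⌉ := by exact_mod_cast h1
      have h3 : (0 : ℝ) < (1 / 4 : ℝ) ^ k := by positivity
      nlinarith
    · intro l _
      rw [sub_nonneg]
      gcongr
  rw [(summable_dyadicJump hx').tsum_sub (summable_dyadicJump hx)] at hle
  unfold dyadicJump
  linarith

/-- At a point that is not dyadic every ceiling in the series is locally constant, and the terms are
dominated by `(1 / 2) ^ k` uniformly near `x`. -/
theorem continuousAt_dyadicJump {x : ℝ} (hx : x ∈ Ioo (0 : ℝ) 1)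
    (hd : ∀ (m : ℤ) (k : ℕ), x ≠ m / 2 ^ k) : ContinuousAt dyadicJump x := by
  refine continuousAt_id.add ?_
  refine tendsto_tsum_of_dominated_convergence
    (summable_geometric_of_lt_one (r := (1 / 2 : ℝ)) (by norm_num) (by norm_num)) (fun k => ?_) ?_
  · have hc : (2 : ℝ) ^ k * x ≠ ⌈(2 : ℝ) ^ k * x⌉ := fun h => hd ⌈(2 : ℝ) ^ k * x⌉ k (by
      rw [← h]; field_simp)
    have hmem : (2 : ℝ) ^ k * x ∈ Ioo ((⌈(2 : ℝ) ^ k * x⌉ : ℝ) - 1) ⌈(2 : ℝ) ^ k * x⌉ :=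
      ⟨by linarith [Int.ceil_lt_add_one ((2 : ℝ) ^ k * x)], lt_of_le_of_ne (Int.le_ceil _) hc⟩
    have hev : ∀ᶠ y in 𝓝 x, (2 : ℝ) ^ k * y ∈
        Ioo ((⌈(2 : ℝ) ^ k * x⌉ : ℝ) - 1) ⌈(2 : ℝ) ^ k * x⌉ :=
      (continuous_const.mul continuous_id).continuousAt.eventually (Ioo_mem_nhds hmem.1 hmem.2)
    refine tendsto_const_nhds.congr' ?_
    filter_upwards [hev] with y hy
    have : ⌈(2 : ℝ) ^ k * y⌉ = ⌈(2 : ℝ) ^ k * x⌉ := Int.ceil_eq_iff.2 ⟨hy.1, hy.2.le⟩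
    rw [this]
  · filter_upwards [Ioo_mem_nhds hx.1 hx.2] with y hy k
    have := dyadicJump_term_bound ⟨hy.1.le, hy.2.le⟩ k
    rw [Real.norm_of_nonneg this.1]
    exact this.2

/-- The generalized inverse of `dyadicJump`. -/
noncomputable def dyadicStair (y : ℝ) : I := sSup {x : I | dyadicJump x ≤ y}

theorem dyadicStair_mono : Monotone dyadicStair := fun _ _ h =>
  sSup_le_sSup fun _ hx => le_trans hx h

theorem dyadicStair_eq {x : I} {y : ℝ} (h : dyadicJump x ≤ y)
    (h' : ∀ x' : I, x < x' → y < dyadicJump x') : dyadicStair y = x :=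
  le_antisymm (sSup_le fun x' hx' => not_lt.1 fun hlt => absurd (h' x' hlt) (not_lt.2 hx'))
    (le_sSup h)

theorem dyadicStair_dyadicJump (x : I) : dyadicStair (dyadicJump x) = x :=
  dyadicStair_eq le_rfl fun x' h => dyadicJump_lt x.2 x'.2 h

/-- A monotone surjection has no jumps; `dyadicJump` is a right inverse. -/
theorem continuous_dyadicStair : Continuous dyadicStair :=
  dyadicStair_mono.continuous_of_surjective fun x => ⟨_, dyadicStair_dyadicJump x⟩

/-- The gap which `dyadicJump` leaves above its value at a dyadic point becomes a plateau of the
inverse. -/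
theorem exists_dyadicStair_eq {x : I} (hx : IsDyadic x) :
    ∃ c d : ℝ, c < d ∧ ∀ y ∈ Icc c d, dyadicStair y = x := by
  obtain ⟨m, k, hm⟩ := hx
  refine ⟨dyadicJump x, dyadicJump x + (1 / 4) ^ k, by simp, fun y hy => ?_⟩
  exact dyadicStair_eq hy.1 fun x' h => hy.2.trans_lt (dyadicJump_add_lt x.2 x'.2 h hm)

theorem isDyadic_zero : IsDyadic 0 := ⟨0, 0, by simp⟩

theorem isDyadic_one : IsDyadic 1 := ⟨1, 0, by simp⟩

theorem isDyadic_half : IsDyadic halfPt := ⟨1, 1, by simp [halfPt]⟩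

/-- A plateau over `[c,d]` means that `dyadicJump` is at least `d` to the right of `x` and at most
`c` to the left. If `x` were not dyadic, continuity at `x` would give `d ≤ c`. -/
theorem isDyadic_of_dyadicStair_eq {x : I} {c d : ℝ} (hcd : c < d)
    (h : ∀ y ∈ Icc c d, dyadicStair y = x) : IsDyadic x := by
  by_contra hx
  have h0 : (0 : ℝ) < x := lt_of_le_of_ne x.2.1 fun h0 =>
    hx ((show (0 : I) = x from Subtype.ext h0) ▸ isDyadic_zero)
  have h1 : (x : ℝ) < 1 := lt_of_le_of_ne x.2.2 fun h1 =>
    hx ((show (1 : I) = x from Subtype.ext h1.symm) ▸ isDyadic_one)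
  have hc := continuousAt_dyadicJump ⟨h0, h1⟩ fun m k hm => hx ⟨m, k, hm⟩
  have hge : d ≤ dyadicJump x := by
    refine ge_of_tendsto (hc.tendsto.mono_left (nhdsWithin_le_nhds (s := Ioi (x : ℝ)))) ?_
    filter_upwards [Ioo_mem_nhdsGT h1] with z hz
    by_contra hlt
    have : (⟨z, h0.le.trans hz.1.le, hz.2.le⟩ : I) ≤ x := by
      refine le_trans ?_ (h d ⟨hcd.le, le_rfl⟩).le
      exact le_sSup (a := (⟨z, h0.le.trans hz.1.le, hz.2.le⟩ : I)) (not_le.1 hlt).le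
    exact absurd hz.1 (not_lt.2 this)
  have hle : dyadicJump x ≤ c := by
    refine le_of_tendsto (hc.tendsto.mono_left (nhdsWithin_le_nhds (s := Iio (x : ℝ)))) ?_
    filter_upwards [Ioo_mem_nhdsLT h0] with z hz
    by_contra hlt
    have : x ≤ (⟨z, hz.1.le, hz.2.le.trans h1.le⟩ : I) := by
      refine (h c ⟨le_rfl, hcd.le⟩).ge.trans ?_
      refine sSup_le fun z' hz' => not_lt.1 fun hlt' => ?_
      have := dyadicJump_lt ⟨hz.1.le, hz.2.le.trans h1.le⟩ z'.2 hlt'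
      exact absurd (le_trans this.le hz') hlt
    exact absurd hz.2 (not_lt.2 this)
  linarith

/-- A continuous monotonous function on `[a,b]` whose stop values are the dyadic numbers in its
image, without the value at `a` if `f0` holds, and without the value at `b` if `f1` holds. -/
structure IsStair (f0 f1 : Prop) (ω : I → I) (a b : I) : Prop where
  lt : a < b
  cont : ContinuousOn ω (Icc a b)
  mono : MonotoneOn ω (Icc a b) ∨ AntitoneOn ω (Icc a b)
  isStopValue_iff : ∀ w, IsStopValue ω (Icc a b) w ↔
    w ∈ ω '' Icc a b ∧ IsDyadic w ∧ ¬(f0 ∧ w = ω a) ∧ ¬(f1 ∧ w = ω b)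

/-- An affine change of time applied to `dyadicStair`. If `s = s'`, the function is constant and `s`
is a stop value, which is why `s` has to be dyadic in this case. -/
theorem exists_isStair {a b : I} (hab : a < b) {s s' : I} (hs : s ≤ s')
    (hd : s < s' ∨ IsDyadic s) : ∃ ω, IsStair False False ω a b ∧ ω a = s ∧ ω b = s' := by
  -- If `s` is dyadic, `y0` is the beginning of a plateau, and below `y1` is the end of one. Thus
  -- the values at the two ends also become stop values.
  obtain ⟨y0, hy0, hy0'⟩ : ∃ y0, dyadicStair y0 = s ∧
      (IsDyadic s → ∃ d > y0, ∀ y ∈ Icc y0 d, dyadicStair y = s) := by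
    by_cases h : IsDyadic s
    · obtain ⟨c, d, hcd, hy⟩ := exists_dyadicStair_eq h
      exact ⟨c, hy c ⟨le_rfl, hcd.le⟩, fun _ => ⟨d, hcd, hy⟩⟩
    · exact ⟨_, dyadicStair_dyadicJump s, fun h' => absurd h' h⟩
  obtain ⟨y1, hy1, hy1', hlt⟩ : ∃ y1, dyadicStair y1 = s' ∧
      (IsDyadic s' → ∃ c < y1, ∀ y ∈ Icc c y1, dyadicStair y = s') ∧ y0 < y1 := by
    rcases eq_or_lt_of_le hs with h | h
    · subst h
      obtain ⟨d, hd', hy⟩ := hy0' (hd.resolve_left (lt_irrefl _))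
      exact ⟨d, hy d ⟨hd'.le, le_rfl⟩, fun _ => ⟨y0, hd', hy⟩, hd'⟩
    · have key : ∀ y1, dyadicStair y1 = s' → y0 < y1 := fun y1 e => by
        by_contra hle
        have := dyadicStair_mono (not_lt.1 hle)
        rw [e, hy0] at this
        exact absurd h (not_lt.2 this)
      by_cases h' : IsDyadic s'
      · obtain ⟨c, d, hcd, hy⟩ := exists_dyadicStair_eq h'
        have e := hy d ⟨hcd.le, le_rfl⟩
        exact ⟨d, e, fun _ => ⟨c, hcd, hy⟩, key d e⟩
      · have e := dyadicStair_dyadicJump s'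
        exact ⟨_, e, fun h'' => absurd h'' h', key _ e⟩
  have hab' : (a : ℝ) < b := hab
  set r : ℝ := (y1 - y0) / (b - a) with hr
  have hr0 : 0 < r := div_pos (by linarith) (by linarith)
  have hrb : y0 + r * ((b : ℝ) - a) = y1 := by
    rw [hr]; field_simp [sub_ne_zero.2 hab'.ne']; ring
  set f : I → ℝ := fun t => y0 + r * ((t : ℝ) - a) with hf
  have hfm : StrictMono f := fun t t' h => by
    have h' : (t : ℝ) < t' := h
    simp only [hf]; nlinarith
  have hfc : Continuous f := by fun_prop
  have hfa : f a = y0 := by simp [hf]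
  have hfb : f b = y1 := hrb
  have hsurj : ∀ y ∈ Icc y0 y1, ∃ t ∈ Icc a b, f t = y := fun y hy => by
    have := intermediate_value_Icc hab.le hfc.continuousOn (hfa ▸ hfb ▸ hy)
    exact this
  have hmono : Monotone (dyadicStair ∘ f) := dyadicStair_mono.comp hfm.monotone
  -- Plateaus of `dyadicStair` inside `[y0,y1]` pull back along the affine map `f`.
  have hsv : ∀ c d, y0 ≤ c → c < d → d ≤ y1 → ∀ w, (∀ y ∈ Icc c d, dyadicStair y = w) →
      IsStopValue (dyadicStair ∘ f) (Icc a b) w := by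
    intro c d hc hcd hd w hw
    obtain ⟨t, ht, rfl⟩ := hsurj c ⟨hc, hcd.le.trans hd⟩
    obtain ⟨t', ht', rfl⟩ := hsurj d ⟨hc.trans hcd.le, hd⟩
    exact ⟨t, t', hfm.lt_iff_lt.1 hcd, Icc_subset_Icc ht.1 ht'.2, fun x hx =>
      hw _ ⟨hfm.monotone hx.1, hfm.monotone hx.2⟩⟩
  refine ⟨dyadicStair ∘ f, ⟨hab, (continuous_dyadicStair.comp hfc).continuousOn,
    Or.inl (hmono.monotoneOn _), fun w => ⟨?_, ?_⟩⟩, ?_, ?_⟩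
  · rintro ⟨t, t', htt, hsub, hw⟩
    refine ⟨⟨t, hsub ⟨le_rfl, htt.le⟩, hw t ⟨le_rfl, htt.le⟩⟩, ?_, by simp, by simp⟩
    refine isDyadic_of_dyadicStair_eq (hfm htt) fun y hy => ?_
    obtain ⟨x, hx, rfl⟩ := intermediate_value_Icc htt.le hfc.continuousOn hy
    exact hw x hx
  · rintro ⟨⟨t, ht, rfl⟩, hw, -, -⟩
    rcases eq_or_ne (dyadicStair (f t)) s with h0 | h0
    · rcases eq_or_lt_of_le hs with h | h
      · subst h
        refine hsv y0 y1 le_rfl hlt le_rfl _ fun y hy => (?_ : _ = dyadicStair (f t))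
        rw [h0]
        exact le_antisymm (hy1 ▸ dyadicStair_mono hy.2) (hy0 ▸ dyadicStair_mono hy.1)
      · obtain ⟨d, hd', hy⟩ := hy0' (h0 ▸ hw)
        refine hsv y0 d le_rfl hd' ?_ _ fun y hy' => (hy y hy').trans h0.symm
        by_contra hlt'
        have := dyadicStair_mono (not_le.1 hlt').le
        rw [hy1, hy d ⟨hd'.le, le_rfl⟩] at this
        exact absurd h (not_lt.2 this)
    · rcases eq_or_ne (dyadicStair (f t)) s' with h1 | h1
      · obtain ⟨c, hc', hy⟩ := hy1' (h1 ▸ hw)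
        refine hsv c y1 ?_ hc' le_rfl _ fun y hy' => (hy y hy').trans h1.symm
        by_contra hlt'
        have := dyadicStair_mono (not_le.1 hlt').le
        rw [hy0, hy c ⟨le_rfl, hc'.le⟩] at this
        exact h0 (h1.trans (le_antisymm this hs))
      -- For a value different from `s` and `s'`, monotonicity keeps the whole plateau inside
      -- `[y0,y1]`.
      · obtain ⟨c, d, hcd, hy⟩ := exists_dyadicStair_eq hw
        refine hsv c d ?_ hcd ?_ _ hy
        · by_contra hlt'
          have h2 := dyadicStair_mono (not_le.1 hlt').le
          rw [hy0, hy c ⟨le_rfl, hcd.le⟩] at h2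
          have h3 : s ≤ dyadicStair (f t) := by
            rw [← hy0, ← hfa]; exact hmono ht.1
          exact h0 (le_antisymm h2 h3)
        · by_contra hlt'
          have h2 := dyadicStair_mono (not_le.1 hlt').le
          rw [hy1, hy d ⟨hcd.le, le_rfl⟩] at h2
          have h3 : dyadicStair (f t) ≤ s' := by
            rw [← hy1, ← hfb]; exact hmono ht.2
          exact h1 (le_antisymm h3 h2)
  · simp [hfa, hy0]
  · simp [hfb, hy1]

theorem IsStopValue.congr {ω ω' : I → I} {s : Set I} {w : I} (h : IsStopValue ω s w)
    (hs : ∀ t ∈ s, ω t = ω' t) : IsStopValue ω' s w :=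
  let ⟨a, b, hab, hsub, hw⟩ := h
  ⟨a, b, hab, hsub, fun t ht => (hs t (hsub ht)).symm.trans (hw t ht)⟩

theorem symm_mem_Icc {a b t : I} : t ∈ Icc (σ b) (σ a) ↔ σ t ∈ Icc a b := by
  simp only [mem_Icc, symm_le_comm, le_symm_comm]
  exact and_comm

theorem IsStopValue.symm {ω : I → I} {a b w : I} (h : IsStopValue ω (Icc a b) w) :
    IsStopValue (ω ∘ σ) (Icc (σ b) (σ a)) w := by
  obtain ⟨c, d, hcd, hsub, hw⟩ := h
  exact ⟨σ d, σ c, symm_lt_symm.2 hcd, fun t ht => symm_mem_Icc.2 (hsub (symm_mem_Icc.1 ht)),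
    fun t ht => hw _ (symm_mem_Icc.1 ht)⟩

theorem isStopValue_symm {ω : I → I} {a b w : I} :
    IsStopValue (ω ∘ σ) (Icc (σ b) (σ a)) w ↔ IsStopValue ω (Icc a b) w := by
  refine ⟨fun h => ?_, IsStopValue.symm⟩
  have := h.symm
  rw [symm_symm, symm_symm] at this
  exact this.congr fun t _ => congrArg ω (symm_symm t)

/-- A monotone function taking the same value at two points is constant in between. -/
theorem eq_of_mono_of_eq {ω : I → I} {s : Set I} (h : MonotoneOn ω s ∨ AntitoneOn ω s) {x y z : I}
    (hx : x ∈ s) (hy : y ∈ s) (hz : z ∈ s) (hxy : x ≤ y) (hyz : y ≤ z) (he : ω x = ω z) :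
    ω y = ω x := by
  rcases h with h | h
  · exact le_antisymm (he ▸ h hy hz hyz) (h hx hy hxy)
  · exact le_antisymm (h hx hy hxy) (he ▸ h hy hz hyz)

theorem IsStair.symm {f0 f1 : Prop} {ω : I → I} {a b : I} (h : IsStair f0 f1 ω a b) :
    IsStair f1 f0 (ω ∘ σ) (σ b) (σ a) where
  lt := symm_lt_symm.2 h.lt
  cont := h.cont.comp continuous_symm.continuousOn fun _ => symm_mem_Icc.1
  mono := h.mono.symm.imp
    (fun h' => h'.comp (strictAnti_symm.antitone.antitoneOn _) fun _ => symm_mem_Icc.1)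
    (fun h' _ hx _ hy hxy => h' (symm_mem_Icc.1 hy) (symm_mem_Icc.1 hx) (symm_le_symm.2 hxy))
  isStopValue_iff w := by
    rw [isStopValue_symm, h.isStopValue_iff]
    have : (ω ∘ σ) '' Icc (σ b) (σ a) = ω '' Icc a b := by
      ext v
      constructor
      · rintro ⟨t, ht, rfl⟩
        exact ⟨σ t, symm_mem_Icc.1 ht, rfl⟩
      · rintro ⟨t, ht, rfl⟩
        exact ⟨σ t, symm_mem_Icc.2 (by rwa [symm_symm]), congrArg ω (symm_symm t)⟩
    rw [this]
    simp only [Function.comp_apply, symm_symm]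
    tauto

/-- Restriction to an initial segment that ends during a stop. -/
theorem IsStair.left {f0 f1 : Prop} {ω : I → I} {a b : I} (h : IsStair f0 f1 ω a b)
    {c c1 c2 : I} (h1 : c1 < c) (h2 : c < c2) (hac1 : a ≤ c1) (hc2b : c2 ≤ b)
    (hc : ∀ t ∈ Icc c1 c2, ω t = ω c) : IsStair f0 False ω a c where
  lt := hac1.trans_lt h1
  cont := h.cont.mono (Icc_subset_Icc le_rfl (h2.le.trans hc2b))
  mono := h.mono.imp (fun h' => h'.mono (Icc_subset_Icc le_rfl (h2.le.trans hc2b)))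
    (fun h' => h'.mono (Icc_subset_Icc le_rfl (h2.le.trans hc2b)))
  isStopValue_iff w := by
    have hcb : c ≤ b := h2.le.trans hc2b
    have hac : a ≤ c := hac1.trans h1.le
    constructor
    · rintro ⟨x, y, hxy, hsub, hw⟩
      have := (h.isStopValue_iff w).1 ⟨x, y, hxy, hsub.trans (Icc_subset_Icc le_rfl hcb), hw⟩
      exact ⟨⟨x, hsub ⟨le_rfl, hxy.le⟩, hw x ⟨le_rfl, hxy.le⟩⟩, this.2.1, this.2.2.1, by simp⟩
    · rintro ⟨⟨t, ht, rfl⟩, hd, h0, -⟩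
      -- The value at `c` keeps the stop `[c1,c]`. Any other value keeps the stop which it has on
      -- `[a,b]`.
      by_cases hv : ω t = ω c
      · exact ⟨c1, c, h1, Icc_subset_Icc hac1 le_rfl, fun s hs =>
          (hc s ⟨hs.1, hs.2.trans h2.le⟩).trans hv.symm⟩
      · have htb : t ∈ Icc a b := ⟨ht.1, ht.2.trans hcb⟩
        -- The exception at `b` does not interfere: if `ω t = ω b`, then `ω` is constant between `t`
        -- and `b`, and `ω t = ω c` follows.
        have hsv : IsStopValue ω (Icc a b) (ω t) :=
          (h.isStopValue_iff _).2 ⟨⟨t, htb, rfl⟩, hd, h0, fun h' =>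
            hv (eq_of_mono_of_eq h.mono htb ⟨hac, hcb⟩ ⟨h.lt.le, le_rfl⟩ ht.2 hcb h'.2).symm⟩
        obtain ⟨x, y, hxy, hsub, hw⟩ := hsv
        -- A stop reaching beyond `c` would contain `c`, or would start after `c` and force `ω` to
        -- be constant from `t` on.
        have hy : y ≤ c := by
          by_contra hcy
          rw [not_le] at hcy
          rcases le_total x c with hxc | hcx
          · exact hv (hw c ⟨hxc, hcy.le⟩).symm
          · exact hv (eq_of_mono_of_eq h.mono htb ⟨hac, hcb⟩ (hsub ⟨le_rfl, hxy.le⟩) ht.2 hcx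
              (hw x ⟨le_rfl, hxy.le⟩).symm).symm
        exact ⟨x, y, hxy, fun s hs => ⟨(hsub hs).1, hs.2.trans hy⟩, hw⟩

/-- Restriction to a final segment that starts during a stop. -/
theorem IsStair.right {f0 f1 : Prop} {ω : I → I} {a b : I} (h : IsStair f0 f1 ω a b)
    {c c1 c2 : I} (h1 : c1 < c) (h2 : c < c2) (hac1 : a ≤ c1) (hc2b : c2 ≤ b)
    (hc : ∀ t ∈ Icc c1 c2, ω t = ω c) : IsStair False f1 ω c b := by
  have := (h.symm.left (symm_lt_symm.2 h2) (symm_lt_symm.2 h1) (symm_le_symm.2 hc2b)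
    (symm_le_symm.2 hac1) fun t ht => (hc _ (symm_mem_Icc.1 ht)).trans
      (congrArg ω (symm_symm c).symm)).symm
  rw [symm_symm, symm_symm] at this
  convert this using 1
  funext t
  simp

/-! ## The maps `λ_μ` -/

/-- The image of `λ_μ` is `[1/2,1]` for `true`, and `[0,1/2]` for `false`; for the constant
maps there is no value. -/
def Kind.side : Kind → Option Bool
  | .plusUp => some true
  | .plusLow => some false
  | .minusUp => some true
  | .minusLow => some false
  | .halfUnder => none
  | .halfOver => none

/-- The two halves of the unit interval. -/
def halfSet : Bool → Set I
  | false => Iic halfPt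
  | true => Ici halfPt

/-- The inverse of `λ_μ` on its image. -/
noncomputable def invLam (k : Kind) (v : I) : I :=
  projIcc 0 1 zero_le_one (match k with
    | .plusUp => 2 * v - 1
    | .plusLow => 2 * v
    | .minusUp => 2 - 2 * v
    | .minusLow => 1 - 2 * v
    -- A dummy value for the constant maps, chosen constant so that continuity and monotonicity hold
    -- for every kind.
    | .halfUnder => 0
    | .halfOver => 0)

theorem le_halfPt_iff {v : I} : v ≤ halfPt ↔ (v : ℝ) ≤ 1 / 2 := Iff.rfl

theorem halfPt_le_iff {v : I} : halfPt ≤ v ↔ 1 / 2 ≤ (v : ℝ) := Iff.rfl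

theorem lam_mem_halfSet {k : Kind} {b : Bool} (hk : k.side = some b) (t : I) :
    lam k t ∈ halfSet b := by
  have h0 := t.2.1
  have h1 := t.2.2
  cases k <;> simp only [Kind.side, Option.some.injEq, reduceCtorEq] at hk <;> subst hk <;>
    simp only [halfSet, mem_Iic, mem_Ici, le_halfPt_iff, halfPt_le_iff, lam] <;> linarith

theorem lam_invLam {k : Kind} {b : Bool} (hk : k.side = some b) {v : I} (hv : v ∈ halfSet b) :
    lam k (invLam k v) = v := by
  have h0 := v.2.1
  have h1 := v.2.2
  apply Subtype.ext
  cases k <;> simp only [Kind.side, Option.some.injEq, reduceCtorEq] at hk <;> subst hk <;>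
    simp only [halfSet, mem_Iic, mem_Ici, le_halfPt_iff, halfPt_le_iff] at hv <;>
    simp only [lam, invLam] <;>
    rw [projIcc_of_mem zero_le_one (by constructor <;> linarith)] <;> simp <;> ring

theorem lam_injective {k : Kind} {b : Bool} (hk : k.side = some b) :
    Function.Injective (lam k) := by
  intro t t' h
  have h' := congrArg (fun t : I => (t : ℝ)) h
  apply Subtype.ext
  cases k <;> simp only [Kind.side, reduceCtorEq] at hk <;> simp only [lam] at h' <;> linarith

theorem lam_of_side_none {k : Kind} (hk : k.side = none) (t : I) : lam k t = halfPt := by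
  cases k <;> simp [Kind.side] at hk <;> rfl

theorem continuous_invLam (k : Kind) : Continuous (invLam k) := by
  cases k <;> exact continuous_projIcc.comp (by fun_prop)

theorem invLam_mono (k : Kind) : Monotone (invLam k) ∨ Antitone (invLam k) := by
  have key : ∀ {v w : I}, v ≤ w → (v : ℝ) ≤ w := fun h => h
  cases k
  · exact Or.inl fun v w h => monotone_projIcc _ (by have := key h; dsimp only; linarith)
  · exact Or.inl fun v w h => monotone_projIcc _ (by have := key h; dsimp only; linarith)
  · exact Or.inr fun v w h => monotone_projIcc _ (by have := key h; dsimp only; linarith)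
  · exact Or.inr fun v w h => monotone_projIcc _ (by have := key h; dsimp only; linarith)
  · exact Or.inl fun v w h => le_rfl
  · exact Or.inl fun v w h => le_rfl

/-- Nonconstant `λ_μ` and their inverses are affine with coefficients in `ℤ[1/2]`. -/
theorem isDyadic_lam_iff {k : Kind} {b : Bool} (hk : k.side = some b) (t : I) :
    IsDyadic (lam k t) ↔ IsDyadic t := by
  constructor
  · rintro ⟨m, n, h⟩
    have h2 : (2 : ℝ) ^ n ≠ 0 := by positivity
    cases k <;> simp only [Kind.side, reduceCtorEq] at hk <;> simp only [lam] at h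
    · exact ⟨2 * m - 2 ^ n, n, by
        push_cast; rw [sub_div, div_self h2, mul_div_assoc, ← h]; ring⟩
    · exact ⟨2 * m, n, by push_cast; rw [mul_div_assoc, ← h]; ring⟩
    · exact ⟨2 * 2 ^ n - 2 * m, n, by
        push_cast; rw [sub_div, mul_div_assoc, mul_div_assoc, div_self h2, ← h]; ring⟩
    · exact ⟨2 ^ n - 2 * m, n, by
        push_cast; rw [sub_div, div_self h2, mul_div_assoc, ← h]; ring⟩
  · rintro ⟨m, n, h⟩
    have h2 : (2 : ℝ) ^ n ≠ 0 := by positivity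
    cases k <;> simp only [Kind.side, reduceCtorEq] at hk <;> simp only [lam, h]
    · exact ⟨2 ^ n + m, n + 1, by push_cast; field_simp; try ring⟩
    · exact ⟨m, n + 1, by field_simp; try ring⟩
    · exact ⟨2 * 2 ^ n - m, n + 1, by push_cast; field_simp; try ring⟩
    · exact ⟨2 ^ n - m, n + 1, by push_cast; field_simp; try ring⟩

/-- On the half in question `invLam k` is injective with inverse `lam k`, so level sets correspond,
and with them the stops, the image and the two end values; being dyadic is preserved as well. -/
theorem IsStair.invLam {f0 f1 : Prop} {ω : I → I} {a b : I} (h : IsStair f0 f1 ω a b) {k : Kind}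
    {c : Bool} (hk : k.side = some c) (hω : ∀ t ∈ Icc a b, ω t ∈ halfSet c) :
    IsStair f0 f1 (invLam k ∘ ω) a b where
  lt := h.lt
  cont := (continuous_invLam k).comp_continuousOn h.cont
  mono := by
    rcases invLam_mono k with h1 | h1 <;> rcases h.mono with h2 | h2
    · exact Or.inl (h1.comp_monotoneOn h2)
    · exact Or.inr (h1.comp_antitoneOn h2)
    · exact Or.inr (h1.comp_monotoneOn h2)
    · exact Or.inl (h1.comp_antitoneOn h2)
  isStopValue_iff w := by
    have key : ∀ t ∈ Icc a b, ∀ w, (_root_.invLam k ∘ ω) t = w ↔ ω t = lam k w := fun t ht w =>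
      ⟨fun e => by rw [← e]; exact (lam_invLam hk (hω t ht)).symm,
        fun e => lam_injective hk ((lam_invLam hk (hω t ht)).trans e)⟩
    have e1 : IsStopValue (_root_.invLam k ∘ ω) (Icc a b) w ↔
        IsStopValue ω (Icc a b) (lam k w) := by
      constructor
      · rintro ⟨x, y, hxy, hsub, hw⟩
        exact ⟨x, y, hxy, hsub, fun t ht => (key t (hsub ht) w).1 (hw t ht)⟩
      · rintro ⟨x, y, hxy, hsub, hw⟩
        exact ⟨x, y, hxy, hsub, fun t ht => (key t (hsub ht) w).2 (hw t ht)⟩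
    have e2 : w ∈ (_root_.invLam k ∘ ω) '' Icc a b ↔ lam k w ∈ ω '' Icc a b := by
      constructor
      · rintro ⟨t, ht, e⟩
        exact ⟨t, ht, (key t ht w).1 e⟩
      · rintro ⟨t, ht, e⟩
        exact ⟨t, ht, (key t ht w).2 e⟩
    have e3 : ∀ t ∈ Icc a b, w = (_root_.invLam k ∘ ω) t ↔ lam k w = ω t := fun t ht => by
      rw [eq_comm, key t ht, eq_comm]
    rw [e1, e2, h.isStopValue_iff, isDyadic_lam_iff hk, e3 a ⟨le_rfl, h.lt.le⟩, e3 b ⟨h.lt.le, le_rfl⟩]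

/-! ## Points of the groupoid model -/

namespace BuildingBlock

variable (B : BuildingBlock)

theorem bGraph_right_unique {r : Bool} {γ : B.E} {η η' : B.F} (h : B.bGraph r γ η)
    (h' : B.bGraph r γ η') : η = η' := PathStep.bGraph_unique B h h'

open Classical in
/-- The normal form of a point of the groupoid model. -/
noncomputable def normalForm : B.G → (I × B.E) ⊕ B.F :=
  Quot.lift
    (fun z => match z with
      | .inl z => if h : ∃ η r, z.1.1 = endpt r ∧ B.bGraph r z.1.2 η then .inr h.choose
          else .inl z.1
      | .inr η => .inr η)
    (by
      rintro _ _ ⟨r, γ, h, η, hb⟩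
      have hex : ∃ η r', endpt r = endpt r' ∧ B.bGraph r' γ η := ⟨η, r, rfl, hb⟩
      simp only [dif_pos hex]
      obtain ⟨r', hr, hb'⟩ := hex.choose_spec
      obtain rfl := endpt_injective hr
      exact congrArg Sum.inr (B.bGraph_right_unique hb' hb))

theorem normalForm_vertex (η : B.F) : B.normalForm (B.vertex η) = .inr η := rfl

theorem normalForm_edge {t : I} {γ : B.E} (h : B.Adm t γ) (ht : ∀ r, t ≠ endpt r) :
    B.normalForm (B.edge t γ h) = .inl (t, γ) := by
  have : ¬ ∃ η r, t = endpt r ∧ B.bGraph r γ η := by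
    rintro ⟨-, r, hr, -⟩
    exact ht r hr
  simp only [normalForm, edge]
  rw [dif_neg this]

theorem exists_edge_endpt {t : I} {γ : B.E} (h : B.Adm t γ) {r : Bool} (ht : t = endpt r) :
    ∃ η, B.edge t γ h = B.vertex η := by
  subst ht
  obtain ⟨η, hη⟩ := h r rfl
  exact ⟨η, B.edge_eq_vertex h hη⟩

theorem exists_eq_endpt_of_edge_eq_vertex {t : I} {γ : B.E} {h : B.Adm t γ} {η : B.F}
    (e : B.edge t γ h = B.vertex η) : ∃ r, t = endpt r := by
  by_contra ht
  push Not at ht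
  have := congrArg B.normalForm e
  rw [B.normalForm_edge h ht, normalForm_vertex] at this
  cases this

/-- Nothing is glued to `[t,γ]` for `0 < t < 1`, so `normalForm` recovers the pair. -/
theorem edge_inj {t t' : I} {γ γ' : B.E} {h : B.Adm t γ} {h' : B.Adm t' γ'}
    (e : B.edge t γ h = B.edge t' γ' h') (ht : ∀ r, t ≠ endpt r) : t = t' ∧ γ = γ' := by
  by_cases ht' : ∃ r, t' = endpt r
  · obtain ⟨r, hr⟩ := ht'
    obtain ⟨η, hη⟩ := B.exists_edge_endpt h' hr
    obtain ⟨r, hr⟩ := B.exists_eq_endpt_of_edge_eq_vertex (e.trans hη)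
    exact absurd hr (ht r)
  · push Not at ht'
    have := congrArg B.normalForm e
    rw [B.normalForm_edge h ht, B.normalForm_edge h' ht'] at this
    exact Prod.mk.inj (Sum.inl.inj this)

theorem vertex_injective : Function.Injective B.vertex := fun η η' e => by
  have := congrArg B.normalForm e
  rwa [normalForm_vertex, normalForm_vertex, Sum.inr.injEq] at this

end BuildingBlock

theorem halfPt_ne_endpt (r : Bool) : halfPt ≠ endpt r := by
  intro h
  have h' := congrArg (fun t : I => (t : ℝ)) h
  cases r <;> norm_num [halfPt, endpt] at h'

/-! ### Pieces of paths and their concatenations -/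

theorem IsStair.congr_flags {f0 f1 g0 g1 : Prop} {ω : I → I} {a b : I} (h : IsStair f0 f1 ω a b)
    (h0 : f0 ↔ g0) (h1 : f1 ↔ g1) : IsStair g0 g1 ω a b := by
  rwa [← propext h0, ← propext h1]

/-- On `[a,b]`, the path `ξ` is of the form `[ω(t),γ]` with a staircase function `ω`.  If `e0` is
not `none`, then `ω(a) ∈ {0,1}` is not a stop value, and `e0` consists of `γ` and this value;
and similarly for `e1` at `b`. -/
structure IsPiece (B : BuildingBlock) (ξ : I → B.G) (e0 e1 : Option (B.E × I)) (a b : I) (γ : B.E)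
    (ω : I → I) : Prop where
  stair : IsStair (e0 ≠ none) (e1 ≠ none) ω a b
  exc0 : ∀ z, e0 = some z → z = (γ, ω a) ∧ ∃ r, ω a = endpt r
  exc1 : ∀ z, e1 = some z → z = (γ, ω b) ∧ ∃ r, ω b = endpt r
  edge : ∀ t ∈ Icc a b, ∃ h : B.Adm (ω t) γ, ξ t = B.edge (ω t) γ h

/-- Finite concatenations of pieces, exceptions being allowed at both ends only. -/
inductive PieceChain (B : BuildingBlock) (ξ : I → B.G) :
    Option (B.E × I) → Option (B.E × I) → I → I → Prop
  | single {e0 e1 a b γ ω} (h : IsPiece B ξ e0 e1 a b γ ω) : PieceChain B ξ e0 e1 a b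
  | trans {e0 e1 a b c} (h : PieceChain B ξ e0 none a b) (h' : PieceChain B ξ none e1 b c) :
      PieceChain B ξ e0 e1 a c

section Pieces

variable {B : BuildingBlock} {ξ ξ' : I → B.G} {e0 e1 : Option (B.E × I)} {a b : I}

theorem IsPiece.congr {γ : B.E} {ω : I → I} (h : IsPiece B ξ e0 e1 a b γ ω)
    (he : ∀ t ∈ Icc a b, ξ t = ξ' t) : IsPiece B ξ' e0 e1 a b γ ω where
  stair := h.stair
  exc0 := h.exc0
  exc1 := h.exc1
  edge t ht := let ⟨h1, h2⟩ := h.edge t ht; ⟨h1, (he t ht).symm.trans h2⟩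

theorem IsPiece.symm {γ : B.E} {ω : I → I} (h : IsPiece B ξ e0 e1 a b γ ω) :
    IsPiece B (ξ ∘ σ) e1 e0 (σ b) (σ a) γ (ω ∘ σ) where
  stair := h.stair.symm
  exc0 z hz := by simpa using h.exc1 z hz
  exc1 z hz := by simpa using h.exc0 z hz
  edge t ht := h.edge (σ t) (symm_mem_Icc.1 ht)

theorem PieceChain.lt (h : PieceChain B ξ e0 e1 a b) : a < b := by
  induction h with
  | single h => exact h.stair.lt
  | trans _ _ h1 h2 => exact h1.trans h2

theorem PieceChain.congr (h : PieceChain B ξ e0 e1 a b) (he : ∀ t ∈ Icc a b, ξ t = ξ' t) :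
    PieceChain B ξ' e0 e1 a b := by
  induction h with
  | single h => exact .single (h.congr he)
  | trans h1 h2 i1 i2 =>
    exact .trans (i1 fun t ht => he t ⟨ht.1, ht.2.trans h2.lt.le⟩)
      (i2 fun t ht => he t ⟨h1.lt.le.trans ht.1, ht.2⟩)

theorem PieceChain.symm (h : PieceChain B ξ e0 e1 a b) :
    PieceChain B (ξ ∘ σ) e1 e0 (σ b) (σ a) := by
  induction h with
  | single h => exact .single h.symm
  | trans _ _ i1 i2 => exact .trans i2 i1

theorem IsPiece.left {γ : B.E} {ω : I → I} (h : IsPiece B ξ e0 e1 a b γ ω)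
    {c c1 c2 : I} (h1 : c1 < c) (h2 : c < c2) (hac1 : a ≤ c1) (hc2b : c2 ≤ b)
    (hc : ∀ t ∈ Icc c1 c2, ω t = ω c) : IsPiece B ξ e0 none a c γ ω where
  stair := (h.stair.left h1 h2 hac1 hc2b hc).congr_flags Iff.rfl (by simp)
  exc0 := h.exc0
  exc1 := by simp
  edge t ht := h.edge t ⟨ht.1, ht.2.trans (h2.le.trans hc2b)⟩

theorem IsPiece.right {γ : B.E} {ω : I → I} (h : IsPiece B ξ e0 e1 a b γ ω)
    {c c1 c2 : I} (h1 : c1 < c) (h2 : c < c2) (hac1 : a ≤ c1) (hc2b : c2 ≤ b)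
    (hc : ∀ t ∈ Icc c1 c2, ω t = ω c) : IsPiece B ξ none e1 c b γ ω where
  stair := (h.stair.right h1 h2 hac1 hc2b hc).congr_flags (by simp) Iff.rfl
  exc0 := by simp
  exc1 := h.exc1
  edge t ht := h.edge t ⟨(hac1.trans h1.le).trans ht.1, ht.2⟩

end Pieces

/-! ### Partial lifts and their concatenation -/

namespace PathStep

variable {A : BuildingBlock} (S : PathStep A)

/-- There is a lift of `ξ` on `[a,b]` from `x` to `y` which is a concatenation of pieces. -/
def Lifts (ξ : I → A.G) (e0 e1 : Option (S.next.E × I)) (a b : I) (x y : S.H) : Prop :=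
  ∃ ζ : I → S.H, ContinuousOn ζ (Icc a b) ∧ ζ a = x ∧ ζ b = y ∧
    (∀ t ∈ Icc a b, S.p (ζ t) = ξ t) ∧ PieceChain S.next (S.incl ∘ ζ) e0 e1 a b

variable {S} {ξ : I → A.G} {e0 e1 : Option (S.next.E × I)} {a b c : I} {x y z : S.H}

theorem Lifts.symm (h : S.Lifts ξ e0 e1 a b x y) : S.Lifts (ξ ∘ σ) e1 e0 (σ b) (σ a) y x := by
  obtain ⟨ζ, hc, ha, hb, hp, h⟩ := h
  exact ⟨ζ ∘ σ, hc.comp continuous_symm.continuousOn fun _ => symm_mem_Icc.1,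
    by simp [hb], by simp [ha], fun t ht => hp _ (symm_mem_Icc.1 ht), h.symm⟩

theorem Lifts.congr {ξ' : I → A.G} (h : S.Lifts ξ e0 e1 a b x y)
    (he : ∀ t ∈ Icc a b, ξ t = ξ' t) : S.Lifts ξ' e0 e1 a b x y := by
  obtain ⟨ζ, hc, ha, hb, hp, h⟩ := h
  exact ⟨ζ, hc, ha, hb, fun t ht => (hp t ht).trans (he t ht), h⟩

theorem Lifts.of_symm (h : S.Lifts (ξ ∘ σ) e1 e0 (σ b) (σ a) y x) : S.Lifts ξ e0 e1 a b x y := by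
  have := h.symm
  rw [symm_symm, symm_symm] at this
  exact this.congr fun t _ => congrArg ξ (symm_symm t)

theorem Lifts.lt (h : S.Lifts ξ e0 e1 a b x y) : a < b := by
  obtain ⟨ζ, -, -, -, -, h⟩ := h
  exact h.lt

/-- The value at the junction `b` is retained here, since (P2) for the final lift is read off from a
vertex at the junction. -/
theorem Lifts.exists_trans (h : S.Lifts ξ e0 none a b x y) (h' : S.Lifts ξ none e1 b c y z) :
    ∃ ζ : I → S.H, ContinuousOn ζ (Icc a c) ∧ ζ a = x ∧ ζ b = y ∧ ζ c = z ∧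
    (∀ t ∈ Icc a c, S.p (ζ t) = ξ t) ∧ PieceChain S.next (S.incl ∘ ζ) e0 e1 a c := by
  obtain ⟨ζ, hc, ha, hb, hp, h⟩ := h
  obtain ⟨ζ', hc', ha', hb', hp', h'⟩ := h'
  have e1 : ∀ t ∈ Icc a b, (if t ≤ b then ζ t else ζ' t) = ζ t := fun t ht => if_pos ht.2
  have e2 : ∀ t ∈ Icc b c, (if t ≤ b then ζ t else ζ' t) = ζ' t := fun t ht => by
    rcases eq_or_lt_of_le ht.1 with rfl | hlt
    · rw [if_pos le_rfl, hb, ha']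
    · rw [if_neg (not_le.2 hlt)]
  have hU : Icc a b ∪ Icc b c = Icc a c := Icc_union_Icc_eq_Icc h.lt.le h'.lt.le
  refine ⟨fun t => if t ≤ b then ζ t else ζ' t, ?_, ?_, ?_, ?_, ?_, ?_⟩
  · rw [← hU]
    exact (hc.congr e1).union_of_isClosed (hc'.congr e2) isClosed_Icc isClosed_Icc
  · exact (e1 a ⟨le_rfl, h.lt.le⟩).trans ha
  · exact (e1 b ⟨h.lt.le, le_rfl⟩).trans hb
  · exact (e2 c ⟨h'.lt.le, le_rfl⟩).trans hb'
  · intro t ht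
    rw [← hU] at ht
    rcases ht with ht | ht
    · exact (congrArg S.p (e1 t ht)).trans (hp t ht)
    · exact (congrArg S.p (e2 t ht)).trans (hp' t ht)
  · exact .trans (h.congr fun t ht => congrArg S.incl (e1 t ht).symm)
      (h'.congr fun t ht => congrArg S.incl (e2 t ht).symm)

theorem Lifts.trans (h : S.Lifts ξ e0 none a b x y) (h' : S.Lifts ξ none e1 b c y z) :
    S.Lifts ξ e0 e1 a c x z := by
  obtain ⟨ζ, hc, ha, -, hb, hp, h⟩ := h.exists_trans h'
  exact ⟨ζ, hc, ha, hb, hp, h⟩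

/-- A staircase function along an edge of `H_n`. -/
theorem lifts_edgeH {η : S.EH} {ω : I → I} (hst : IsStair (e0 ≠ none) (e1 ≠ none) ω a b)
    (hadm : ∀ t ∈ Icc a b, S.AdmH (ω t) η) (hp : ∀ t ht, S.pE (ω t) η (hadm t ht) = ξ t)
    (exc0 : ∀ z, e0 = some z → z = (S.inclE η, ω a) ∧ ∃ r, ω a = endpt r)
    (exc1 : ∀ z, e1 = some z → z = (S.inclE η, ω b) ∧ ∃ r, ω b = endpt r)
    {s s' : I} (hs : S.AdmH s η) (hs' : S.AdmH s' η) (ha : ω a = s) (hb : ω b = s') :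
    S.Lifts ξ e0 e1 a b (S.edgeH s η hs) (S.edgeH s' η hs') := by
  classical
  subst ha hb
  -- The value outside of `[a,b]` is a dummy; `[ω t, η]` need not be defined there.
  let ζ : I → S.H := fun t => if ht : t ∈ Icc a b then S.edgeH (ω t) η (hadm t ht)
    else S.edgeH (ω a) η hs
  have hζ : ∀ t (ht : t ∈ Icc a b), ζ t = S.edgeH (ω t) η (hadm t ht) := fun t ht => dif_pos ht
  refine ⟨ζ, ?_, hζ a ⟨le_rfl, hst.lt.le⟩, hζ b ⟨hst.lt.le, le_rfl⟩, fun t ht => ?_, .single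
    (γ := S.inclE η) (ω := ω) ⟨hst, exc0, exc1, fun t ht => ⟨S.adm_inclE (hadm t ht), ?_⟩⟩⟩
  · rw [continuousOn_iff_continuous_domRestrict]
    have : (Icc a b).domRestrict ζ = fun t : Icc a b =>
        (Quot.mk S.GlueH (Sum.inl ⟨(ω t, η), hadm t t.2⟩) : S.H) := by
      funext t
      exact hζ t t.2
    rw [this]
    refine continuous_quot_mk.comp (continuous_inl.comp (Continuous.subtype_mk ?_ _))
    exact (continuousOn_iff_continuous_domRestrict.1 hst.cont).prodMk continuous_const
  · rw [hζ t ht]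
    exact hp t ht
  · exact congrArg S.incl (hζ t ht)

/-! ## Fibres of `𝒑` -/

theorem _root_.finRotate_mk_of_lt {n m : ℕ} (h : m + 1 < n) :
    finRotate n ⟨m, by omega⟩ = ⟨m + 1, h⟩ := by
  cases n with
  | zero => omega
  | succ n => exact finRotate_of_lt (by omega)

variable (S) in
/-- The points `x` and `y` of a fibre of `𝒑` can be connected inside of this fibre, in any
time. -/
def FibreConn (x y : S.H) : Prop :=
  ∀ ξ : I → A.G, ∀ a b : I, a < b → (∀ t ∈ Icc a b, ξ t = S.p x) → S.Lifts ξ none none a b x y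

theorem FibreConn.p_eq (h : S.FibreConn x y) : S.p y = S.p x := by
  obtain ⟨ζ, -, -, h1, hp, -⟩ := h (fun _ => S.p x) 0 1 zero_lt_one fun _ _ => rfl
  rw [← h1]
  exact hp 1 ⟨zero_le_one, le_rfl⟩

theorem FibreConn.symm (h : S.FibreConn x y) : S.FibreConn y x := fun _ _ _ hab hξ =>
  Lifts.of_symm (h _ _ _ (symm_lt_symm.2 hab) fun _ ht => (hξ _ (symm_mem_Icc.1 ht)).trans h.p_eq)

theorem FibreConn.trans (h : S.FibreConn x y) (h' : S.FibreConn y z) : S.FibreConn x z := by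
  intro ξ a b hab hξ
  obtain ⟨c, hac, hcb⟩ := exists_between hab
  exact (h ξ a c hac fun t ht => hξ t ⟨ht.1, ht.2.trans hcb.le⟩).trans
    (h' ξ c b hcb fun t ht => (hξ t ⟨hac.le.trans ht.1, ht.2⟩).trans h.p_eq.symm)

/-- Where `𝒑` is constant along an edge, a staircase function can run from one of its points to
another without leaving the fibre. Resting at one point is a staircase only if the parameter is
dyadic. -/
theorem fibreConn_edgeH {η : S.EH} (hadm : ∀ t, S.AdmH t η)
    (hp : ∀ t t', S.pE t η (hadm t) = S.pE t' η (hadm t')) {s s' : I} (hs : s ≤ s')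
    (hd : s < s' ∨ IsDyadic s) :
    S.FibreConn (S.edgeH s η (hadm s)) (S.edgeH s' η (hadm s')) := by
  intro ξ a b hab hξ
  obtain ⟨ω, hst, ha, hb⟩ := exists_isStair hab hs hd
  exact lifts_edgeH (hst.congr_flags (by simp) (by simp)) (fun t _ => hadm _)
    (fun t ht => (hp _ _).trans (hξ t ht).symm) (by simp) (by simp) _ _ ha hb

theorem edgeH_endpt {r : Bool} {η : S.EH} (h : S.AdmH (endpt r) η) {ζ : S.FH}
    (hb : S.next.bGraph r (S.inclE η) (S.inclF ζ)) : S.edgeH (endpt r) η h = S.vertexH ζ :=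
  Quot.sound (GlueH.mk r η h ζ hb)

theorem exists_edgeH_endpt {r : Bool} {η : S.EH} (h : S.AdmH (endpt r) η) :
    ∃ ζ, S.edgeH (endpt r) η h = S.vertexH ζ :=
  let ⟨ζ, hζ⟩ := S.exists_bGraph r η h
  ⟨ζ, edgeH_endpt h hζ⟩

/-- This is the purpose of enlarging `E^𝔮`. The additional copy of `𝓕_{n+1}[𝒑]` gives an edge on
which `𝒑` is constant; it is glued by the identity at `0` and by `Ad(w)` at `1`, hence it joins two
vertices whose positions differ by `labelPerm`. -/
theorem fibreConn_extra (b b' : FBlock A S.MF) (u : b.pos × b.pos) (v : b'.pos × b'.pos)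
    (h1 : S.labelPerm ⟨b', v.1⟩ = ⟨b, u.1⟩) (h2 : S.labelPerm ⟨b', v.2⟩ = ⟨b, u.2⟩) :
    S.FibreConn (S.vertexH ⟨b, u⟩) (S.vertexH ⟨b', v⟩) := by
  have hadm : ∀ t, S.AdmH t ⟨S.qc, .extra rfl b, u⟩ := fun t r _ => trivial
  have e0 : S.edgeH (endpt false) _ (hadm _) = S.vertexH ⟨b, u⟩ :=
    edgeH_endpt (hadm _) ⟨Sum.inr ⟨rfl⟩, rfl, rfl⟩
  have e1 : S.edgeH (endpt true) _ (hadm _) = S.vertexH ⟨b', v⟩ :=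
    edgeH_endpt (hadm _) ⟨Sum.inr ⟨rfl⟩,
      congrArg Sum.inr (Subtype.ext ((S.w_totF _).trans (congrArg S.totF h1))),
      congrArg Sum.inr (Subtype.ext ((S.w_totF _).trans (congrArg S.totF h2)))⟩
  rw [← e0, ← e1]
  exact fibreConn_edgeH hadm (fun _ _ => rfl) (zero_le_one (α := I)) (Or.inr isDyadic_zero)

/-- A vertex can be connected to itself. -/
theorem fibreConn_vertexH_self (ζ : S.FH) : S.FibreConn (S.vertexH ζ) (S.vertexH ζ) := by
  obtain ⟨b, u⟩ := ζ
  have hadm : ∀ t, S.AdmH t ⟨S.qc, .extra rfl b, u⟩ := fun t r _ => trivial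
  have e0 : S.edgeH (endpt false) _ (hadm _) = S.vertexH ⟨b, u⟩ :=
    edgeH_endpt (hadm _) ⟨Sum.inr ⟨rfl⟩, rfl, rfl⟩
  rw [← e0]
  exact fibreConn_edgeH hadm (fun _ _ => rfl) le_rfl (Or.inr isDyadic_zero)

/-- Two different slots of `p` are exchanged by `flip`, so one additional edge joins them. -/
theorem fibreConn_half (p : A.P) (s s' : A.Slot p) (u : A.Y p × A.Y p) :
    S.FibreConn (S.vertexH ⟨.half p s, u⟩) (S.vertexH ⟨.half p s', u⟩) := by
  by_cases h : s = s'
  · subst h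
    exact fibreConn_vertexH_self _
  -- For `p = p̀` the slot `true` is excluded, so there are no two different slots.
  · have hg : A.grave ≠ some p := by
      intro hg
      have : ∀ s : A.Slot p, s.1 = false := fun s => by
        rw [← Bool.not_eq_true]
        exact fun h => s.2 h hg
      exact h (Subtype.ext ((this s).trans (this s').symm))
    have hf : A.flip p s' = s := by
      refine (dif_neg hg : A.flipFun p s' = ⟨!s'.1, fun _ => hg⟩).trans (Subtype.ext ?_)
      have h' : s.1 ≠ s'.1 := fun e => h (Subtype.ext e)
      change (!s'.1) = s.1
      revert h'
      cases s.1 <;> cases s'.1 <;> simp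
    exact fibreConn_extra _ _ _ _ (S.half_congr hf u.1) (S.half_congr hf u.2)

/-- Each additional edge joins neighbours in the enumeration of the copies of `F_n^i`. Because `w`
permutes these in a single cycle, every copy can be joined step by step to the one numbered `0`. -/
theorem fibreConn_const (i : A.I) (z z' : Σ j, S.MF j i) (u : A.X i × A.X i) :
    S.FibreConn (S.vertexH ⟨.const i z.1 z.2, u⟩) (S.vertexH ⟨.const i z'.1 z'.2, u⟩) := by
  have step : ∀ z, S.FibreConn (S.vertexH ⟨.const i (S.cyc i z).1 (S.cyc i z).2, u⟩)
      (S.vertexH ⟨.const i z.1 z.2, u⟩) := fun z => fibreConn_extra _ _ _ _ rfl rfl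
  have step' : ∀ l : Fin (S.num i),
      S.FibreConn (S.vertexH ⟨.const i (S.enum i (finRotate _ l)).1 (S.enum i (finRotate _ l)).2, u⟩)
      (S.vertexH ⟨.const i (S.enum i l).1 (S.enum i l).2, u⟩) := fun l => by
    have := step (S.enum i l)
    have e : S.cyc i (S.enum i l) = S.enum i (finRotate _ l) := by
      simp [PathData.cyc, Equiv.permCongr_apply]
    rwa [e] at this
  have all : ∀ (m : ℕ) (hm : m < S.num i) (h0 : 0 < S.num i),
      S.FibreConn (S.vertexH ⟨.const i (S.enum i ⟨m, hm⟩).1 (S.enum i ⟨m, hm⟩).2, u⟩)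
      (S.vertexH ⟨.const i (S.enum i ⟨0, h0⟩).1 (S.enum i ⟨0, h0⟩).2, u⟩) := by
    intro m
    induction m with
    | zero => exact fun hm h0 => fibreConn_vertexH_self _
    | succ m ih =>
      intro hm h0
      refine FibreConn.trans ?_ (ih (by omega) h0)
      have := step' ⟨m, by omega⟩
      rwa [finRotate_mk_of_lt hm] at this
  have all' : ∀ z : Σ j, S.MF j i, ∀ h0 : 0 < S.num i,
      S.FibreConn (S.vertexH ⟨.const i z.1 z.2, u⟩)
      (S.vertexH ⟨.const i (S.enum i ⟨0, h0⟩).1 (S.enum i ⟨0, h0⟩).2, u⟩) := fun z h0 => by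
    obtain ⟨⟨m, hm⟩, rfl⟩ := (S.enum i).surjective z
    exact all m hm h0
  have h0 : 0 < S.num i := ((S.enum i).symm z).pos
  exact (all' z h0).trans (all' z' h0).symm

/-- Equal images force the same type of vertex, because `[1/2,γ]` is not a vertex of `G_n`, and then
the same matrix unit. Only the label of the copy can differ, and it can be changed by the two
preceding results. -/
theorem fibreConn_vertexH {ζ ζ' : S.FH} (h : S.pF ζ = S.pF ζ') :
    S.FibreConn (S.vertexH ζ) (S.vertexH ζ') := by
  rcases ζ with ⟨⟨p, s⟩ | ⟨i, j, μ⟩, u⟩ <;> rcases ζ' with ⟨⟨p', s'⟩ | ⟨i', j', μ'⟩, u'⟩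
  · have := (A.edge_inj h halfPt_ne_endpt).2
    cases this
    exact fibreConn_half _ _ _ _
  · obtain ⟨r, hr⟩ := A.exists_eq_endpt_of_edge_eq_vertex h
    exact absurd hr (halfPt_ne_endpt r)
  · obtain ⟨r, hr⟩ := A.exists_eq_endpt_of_edge_eq_vertex h.symm
    exact absurd hr (halfPt_ne_endpt r)
  · have := A.vertex_injective h
    cases this
    exact fibreConn_const i ⟨j, μ⟩ ⟨j', μ'⟩ u

/-- A nonconstant `λ_μ` maps `0` and `1` to the ends of a half interval, and these are the only
points of `{0,1/2,1}` in that half. -/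
theorem exists_endpt_of_lam_special {k : Kind} {c : Bool} (hk : k.side = some c) {t : I}
    (h : lam k t ∈ special) : ∃ r, t = endpt r := by
  rcases h with h | h | h
  · exact exists_endpt_of_lam k t false h
  · have h' := congrArg (fun t : I => (t : ℝ)) h
    suffices hs : (t : ℝ) = 0 ∨ (t : ℝ) = 1 from
      hs.elim (fun h => ⟨false, Subtype.ext h⟩) (fun h => ⟨true, Subtype.ext h⟩)
    cases k <;> simp only [Kind.side, reduceCtorEq] at hk <;> simp only [lam, halfPt] at h'
    · left; linarith
    · right; linarith
    · right; linarith
    · left; linarith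
  · exact exists_endpt_of_lam k t true h

/-- There are two cases. On an edge with nonconstant `λ_μ`, lying over `{0,1/2,1}` forces the
parameter to be `0` or `1`, so the point is a vertex already. On every other edge `𝒑` is constant,
and the edge is followed to its end at `1`. -/
theorem exists_fibreConn_vertexH {v : I} (hv : v ∈ special) {γ : A.E} {h : A.Adm v γ}
    (hx : S.p x = A.edge v γ h) : ∃ ζ, S.FibreConn x (S.vertexH ζ) := by
  have move : ∀ (η : S.EH) (hadm : ∀ t, S.AdmH t η)
      (_ : ∀ t t', S.pE t η (hadm t) = S.pE t' η (hadm t')) (s : I),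
      ∃ ζ, S.FibreConn (S.edgeH s η (hadm s)) (S.vertexH ζ) := by
    intro η hadm hp s
    obtain ⟨ζ, hζ⟩ := exists_edgeH_endpt (hadm (endpt true))
    -- At `s = 1` the motion is a rest, which is allowed because `1` is dyadic.
    refine ⟨ζ, hζ ▸ fibreConn_edgeH hadm hp (le_one' (t := s)) ?_⟩
    rcases eq_or_lt_of_le (le_one' (t := s)) with rfl | hlt
    · exact Or.inr isDyadic_one
    · exact Or.inl hlt
  induction x using Quot.ind with
  | mk x =>
    rcases x with ⟨⟨t, q, b, u⟩, hadm⟩ | ζ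
    · rcases b with (⟨k, p, μ⟩ | ⟨i, μ⟩) | ⟨hq, b⟩
      · rcases hk : k.side with _ | c
        · have hl := lam_of_side_none hk
          refine move _ (fun t r _ => ?_) (fun t t' => ?_) t
          · change A.Adm (lam k (endpt r)) _
            rw [hl]
            exact adm_halfPt _
          · simp only [pE, hl]
        -- Over a vertex of `G_n` the parameter need not equal `v`, but it is `0` or `1`; otherwise
        -- it equals `v`.
        · have hs : lam k t ∈ special := by
            by_cases ht : ∃ r, lam k t = endpt r
            · obtain ⟨r, hr⟩ := ht
              rw [hr]
              cases r <;> simp [special, endpt]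
            · push Not at ht
              have := (A.edge_inj (h := S.adm_lam hadm) hx ht).1
              rwa [this]
          obtain ⟨r, rfl⟩ := exists_endpt_of_lam_special hk hs
          obtain ⟨ζ, hζ⟩ := exists_edgeH_endpt hadm
          refine ⟨ζ, ?_⟩
          change S.FibreConn (S.edgeH _ _ hadm) _
          rw [hζ]
          exact fibreConn_vertexH_self ζ
      · exact move ⟨q, .ofC (.const i μ), u⟩ (fun _ _ _ => trivial) (fun _ _ => rfl) t
      · exact move ⟨q, .extra hq b, u⟩ (fun _ _ _ => trivial) (fun _ _ => rfl) t
    · exact ⟨ζ, fibreConn_vertexH_self ζ⟩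

/-- The fibres of `𝒑` over the points `[v,γ]` with `v ∈ {0,1/2,1}` are connected. -/
theorem fibreConn_of_special {v : I} (hv : v ∈ special) {γ : A.E} {h : A.Adm v γ}
    (hx : S.p x = A.edge v γ h) (hy : S.p y = A.edge v γ h) : S.FibreConn x y := by
  obtain ⟨ζ, hζ⟩ := exists_fibreConn_vertexH hv hx
  obtain ⟨ζ', hζ'⟩ := exists_fibreConn_vertexH hv hy
  have e : S.pF ζ = S.pF ζ' := hζ.p_eq.trans ((hx.trans hy.symm).trans hζ'.p_eq.symm)
  exact (hζ.trans (fibreConn_vertexH e)).trans hζ'.symm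

end PathStep

theorem halfSet_eq {c c' : Bool} {v : I} (h : v ∈ halfSet c) (h' : v ∈ halfSet c')
    (hv : v ≠ halfPt) : c = c' := by
  cases c <;> cases c' <;> simp only [halfSet, mem_Iic, mem_Ici] at h h'
  · rfl
  · exact absurd (le_antisymm h h') hv
  · exact absurd (le_antisymm h' h) hv
  · rfl

theorem eq_of_endpt_mem_halfSet {r c : Bool} (h : endpt r ∈ halfSet c) : r = c := by
  cases r <;> cases c
  · rfl
  · exact absurd (halfPt_le_iff.1 h) (by norm_num [endpt])
  · exact absurd (le_halfPt_iff.1 h) (by norm_num [endpt])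
  · rfl

/-- The image of `λ_μ` lies in one half of the interval or is `{1/2}`, so it contains at most one of
`0` and `1`. -/
theorem endpt_eq_of_lam {k : Kind} {t t' : I} {r r' : Bool} (h : lam k t = endpt r)
    (h' : lam k t' = endpt r') : r = r' := by
  rcases hk : k.side with _ | c
  · exact absurd ((lam_of_side_none hk t).symm.trans h) (halfPt_ne_endpt r)
  · have h1 : r = c := eq_of_endpt_mem_halfSet (h ▸ lam_mem_halfSet hk t)
    have h2 : r' = c := eq_of_endpt_mem_halfSet (h' ▸ lam_mem_halfSet hk t')
    exact h1.trans h2.symm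

theorem exists_mem_halfSet (v : I) : ∃ c, v ∈ halfSet c :=
  (le_total v halfPt).elim (fun h => ⟨false, h⟩) fun h => ⟨true, h⟩

/-! ### Lifting pieces and chains with one prescribed end -/

namespace PathStep

variable {A : BuildingBlock} {S : PathStep A} {ξ : I → A.G} {a b : I}

variable (S) in
/-- Both halves of every edge of `G_n` are images of edges of `H_n`. -/
theorem exists_interior (p : A.P) (c : Bool) :
    ∃ (q : S.dot.P) (k : Kind) (_ : S.MC k q p), k.side = some c := by
  -- Over `p̀` the exceptional index `q̀` supplies the block, where either `λ_+` or `λ_-` covers the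
  -- lower half; for the other `p` some `q ≠ q̀` does.
  by_cases hp : A.grave = some p
  · obtain ⟨q, hq⟩ : ∃ q, S.dot.grave = some q := by
      rw [← Option.ne_none_iff_exists']
      intro h
      rw [S.unital_iff.2 h] at hp
      cases hp
    obtain ⟨⟨μ⟩, h2⟩ := S.mult_grave q p hq hp
    cases c
    · rcases h2 with ⟨⟨μ⟩⟩ | ⟨⟨μ⟩⟩
      · exact ⟨q, _, μ, rfl⟩
      · exact ⟨q, _, μ, rfl⟩
    · exact ⟨q, _, μ, rfl⟩
  · obtain ⟨q, hq⟩ := S.exists_ne_grave p hp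
    obtain ⟨⟨μ⟩, ⟨ν⟩, -⟩ := S.mult q p hq hp
    cases c
    · exact ⟨q, _, ν, rfl⟩
    · exact ⟨q, _, μ, rfl⟩

variable (S) in
/-- If a path starts with an exception, with data `e0`, then the point `x` belongs to an edge
over which the path can be lifted. -/
def StartsAt (e0 : Option (A.E × I)) (x : S.H) : Prop :=
  ∀ γ v, e0 = some (γ, v) → ∃ (q : S.dot.P) (k : Kind) (p : A.P) (μ : S.MC k q p)
    (u : A.Y p × A.Y p) (s : I) (hs : S.AdmH s ⟨q, .ofC (.interior k p μ), u⟩),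
    x = S.edgeH s ⟨q, .ofC (.interior k p μ), u⟩ hs ∧
      (⟨p, u⟩ : Σ p, A.Y p × A.Y p) = γ ∧ lam k s = v

theorem startsAt_none (x : S.H) : S.StartsAt none x := fun _ _ h => by cases h

theorem Lifts.p_right {e0 e1 : Option (S.next.E × I)} {x y : S.H}
    (h : S.Lifts ξ e0 e1 a b x y) : S.p y = ξ b := by
  have hlt := h.lt
  obtain ⟨ζ, -, -, h1, hp, -⟩ := h
  rw [← h1]
  exact hp b ⟨hlt.le, le_rfl⟩

theorem Lifts.p_left {e0 e1 : Option (S.next.E × I)} {x y : S.H}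
    (h : S.Lifts ξ e0 e1 a b x y) : S.p x = ξ a := by
  have hlt := h.lt
  obtain ⟨ζ, -, h1, -, hp, -⟩ := h
  rw [← h1]
  exact hp a ⟨le_rfl, hlt.le⟩

/-- Lifting along an edge of `H_n`. -/
theorem exists_lifts_interior {e0 : Option (A.E × I)} {γ : A.E} {ω : I → I}
    (h : IsPiece A ξ e0 none a b γ ω) {k : Kind} {c : Bool} (hk : k.side = some c)
    (hω : ∀ t ∈ Icc a b, ω t ∈ halfSet c) {q : S.dot.P} {p : A.P} {μ : S.MC k q p}
    {u : A.Y p × A.Y p} (hγ : (⟨p, u⟩ : Σ p, A.Y p × A.Y p) = γ) {s : I}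
    (hs : S.AdmH s ⟨q, .ofC (.interior k p μ), u⟩) (ha : lam k s = ω a) :
    ∃ e0' y, (e0' = none ↔ e0 = none) ∧
      S.Lifts ξ e0' none a b (S.edgeH s ⟨q, .ofC (.interior k p μ), u⟩ hs) y := by
  subst hγ
  set η : S.EH := ⟨q, .ofC (.interior k p μ), u⟩
  have hl : ∀ t ∈ Icc a b, lam k (invLam k (ω t)) = ω t := fun t ht => lam_invLam hk (hω t ht)
  have hab := h.stair.lt
  have hsa : (invLam k ∘ ω) a = s := lam_injective hk ((hl a ⟨le_rfl, hab.le⟩).trans ha.symm)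
  -- At a parameter `0` or `1` of the lift, admissibility in `H_n` is by definition admissibility of
  -- `γ` at the image under `λ_μ`, which is `ω t`.
  have hadm : ∀ t ∈ Icc a b, S.AdmH ((invLam k ∘ ω) t) η := by
    intro t ht r hr
    change A.Adm (lam k (endpt r)) _
    obtain ⟨h1, -⟩ := h.edge t ht
    rw [← hr]
    change A.Adm (lam k (invLam k (ω t))) _
    rwa [hl t ht]
  -- The lift has an exception at `a` exactly if the given piece has one; as `λ_μ` takes the values
  -- `0` and `1` only at endpoints, the starting parameter is again `0` or `1`.
  refine ⟨e0.map fun _ => (S.inclE η, s), S.edgeH _ η (hadm b ⟨hab.le, le_rfl⟩), by simp, ?_⟩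
  refine lifts_edgeH (ω := invLam k ∘ ω) ((h.stair.invLam hk hω).congr_flags (by simp) (by simp))
    hadm (fun t ht => ?_) ?_ (by simp) hs (hadm b ⟨hab.le, le_rfl⟩) hsa rfl
  · obtain ⟨h1, h2⟩ := h.edge t ht
    rw [h2]
    simp only [pE, η, Function.comp_apply, hl t ht]
  · rintro z hz
    obtain ⟨z0, hz0, rfl⟩ := Option.map_eq_some_iff.1 hz
    refine ⟨by rw [hsa], ?_⟩
    obtain ⟨-, r, hr⟩ := h.exc0 z0 hz0
    rw [hsa]
    exact exists_endpt_of_lam k s r (ha.trans hr)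

/-- Vertices of `H_n` lie over vertices of `G_n` or over points `[1/2,γ]` only. -/
theorem pF_eq_edge {ζ : S.FH} {t : I} {γ : A.E} {h : A.Adm t γ} (e : S.pF ζ = A.edge t γ h) :
    t ∈ special := by
  by_cases ht : ∃ r, t = endpt r
  · obtain ⟨r, rfl⟩ := ht
    cases r <;> simp [special, endpt]
  · push Not at ht
    rcases ζ with ⟨⟨p, s⟩ | ⟨i, j, μ⟩, u⟩
    · rw [(A.edge_inj e.symm ht).1]
      simp [special]
    · obtain ⟨r, hr⟩ := A.exists_eq_endpt_of_edge_eq_vertex e.symm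
      exact absurd hr (ht r)

/-- Points over a point `[v,γ]` with `v ∉ {0,1/2,1}`. -/
theorem exists_eq_edgeH_of_not_special {x : S.H} {v : I} {γ : A.E} {h : A.Adm v γ}
    (e : S.p x = A.edge v γ h) (hv : v ∉ special) :
    ∃ (q : S.dot.P) (k : Kind) (p : A.P) (μ : S.MC k q p) (u : A.Y p × A.Y p) (s : I)
      (hs : S.AdmH s ⟨q, .ofC (.interior k p μ), u⟩),
      x = S.edgeH s ⟨q, .ofC (.interior k p μ), u⟩ hs ∧
        (⟨p, u⟩ : Σ p, A.Y p × A.Y p) = γ ∧ lam k s = v := by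
  have hv' : ∀ r, v ≠ endpt r := by
    rintro r rfl
    apply hv
    cases r <;> simp [special, endpt]
  induction x using Quot.ind with
  | mk x =>
    rcases x with ⟨⟨t, q, b, u⟩, hadm⟩ | ζ
    · rcases b with (⟨k, p, μ⟩ | ⟨i, μ⟩) | ⟨hq, b⟩
      · have := A.edge_inj (h' := S.adm_lam hadm) e.symm hv'
        exact ⟨q, k, p, μ, u, t, hadm, rfl, this.2.symm, this.1.symm⟩
      · obtain ⟨r, hr⟩ := A.exists_eq_endpt_of_edge_eq_vertex e.symm
        exact absurd hr (hv' r)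
      · exact absurd (pF_eq_edge (ζ := (⟨b, u⟩ : Σ b : FBlock A S.MF, b.pos × b.pos)) e) hv
    · exact absurd (pF_eq_edge e) hv

/-- Lifting a piece with values in `[0,1/2]` or in `[1/2,1]`. -/
theorem exists_lifts_of_half {e0 : Option (A.E × I)} {γ : A.E} {ω : I → I}
    (h : IsPiece A ξ e0 none a b γ ω) {c : Bool} (hω : ∀ t ∈ Icc a b, ω t ∈ halfSet c) {x : S.H}
    (hx : S.p x = ξ a) (hs : S.StartsAt e0 x) :
    ∃ e0' y, (e0' = none ↔ e0 = none) ∧ S.Lifts ξ e0' none a b x y := by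
  have hab := h.stair.lt
  have haa : a ∈ Icc a b := ⟨le_rfl, hab.le⟩
  -- If `x` lies on an edge over `γ` at a value other than `1/2`, this value determines the half
  -- covered by the edge, so the piece lifts along it.
  have direct : ω a ≠ halfPt → (∃ (q : S.dot.P) (k : Kind) (p : A.P) (μ : S.MC k q p)
      (u : A.Y p × A.Y p) (s : I) (hs : S.AdmH s ⟨q, .ofC (.interior k p μ), u⟩),
      x = S.edgeH s ⟨q, .ofC (.interior k p μ), u⟩ hs ∧
        (⟨p, u⟩ : Σ p, A.Y p × A.Y p) = γ ∧ lam k s = ω a) →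
      ∃ e0' y, (e0' = none ↔ e0 = none) ∧ S.Lifts ξ e0' none a b x y := by
    rintro hne ⟨q, k, p, μ, u, s, hs', rfl, hγ, hv⟩
    rcases hk : k.side with _ | c'
    · exact absurd (hv.symm.trans (lam_of_side_none hk s)) hne
    · obtain rfl := halfSet_eq (hω a haa) (hv ▸ lam_mem_halfSet hk s) hne
      exact exists_lifts_interior h hk hω hγ hs' hv
  obtain ⟨hadm, hξa⟩ := h.edge a haa
  rcases e0 with _ | ⟨γ', v⟩
  -- Without an exception, a start in `{0,1/2,1}` is a stop, and by monotonicity the stop begins at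
  -- `a`. Its first part, up to `m`, is spent on changing the edge.
  · by_cases hsp : ω a ∈ special
    · have hd : IsDyadic (ω a) := by
        rcases hsp with hsp | hsp | hsp
        · exact hsp ▸ isDyadic_zero
        · exact hsp ▸ isDyadic_half
        · exact (mem_singleton_iff.1 hsp) ▸ isDyadic_one
      obtain ⟨c1, c2, hc, hsub, hst⟩ :=
        (h.stair.isStopValue_iff (ω a)).2 ⟨⟨a, haa, rfl⟩, hd, by simp, by simp⟩
      have hac2 : a < c2 := (hsub ⟨le_rfl, hc.le⟩).1.trans_lt hc
      have hc2 : c2 ∈ Icc a b := hsub ⟨hc.le, le_rfl⟩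
      have hconst : ∀ t ∈ Icc a c2, ω t = ω a := fun t ht =>
        eq_of_mono_of_eq h.stair.mono haa ⟨ht.1, ht.2.trans hc2.2⟩ hc2 ht.1 ht.2
          (hst c2 ⟨hc.le, le_rfl⟩).symm
      obtain ⟨m, ham, hmc⟩ := exists_between hac2
      have hm := hconst m ⟨ham.le, hmc.le⟩
      have hmb : m ≤ b := hmc.le.trans hc2.2
      have hr := h.right ham hmc le_rfl hc2.2 fun t ht => (hconst t ht).trans hm.symm
      obtain ⟨p, u⟩ := γ
      -- The new edge covers the half `c`; the lift continues from its point over `[ω a, γ]`, which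
      -- is reached from `x` inside the connected fibre.
      obtain ⟨q, k, μ, hk⟩ := S.exists_interior p c
      have hl := lam_invLam hk (hω a haa)
      have hadm' : S.AdmH (invLam k (ω a)) ⟨q, .ofC (.interior k p μ), u⟩ := by
        intro r hr
        change A.Adm (lam k (endpt r)) _
        rw [← hr, hl]
        exact hadm
      obtain ⟨e0', y, he, hy⟩ := exists_lifts_interior (S := S) hr hk
        (fun t ht => hω t ⟨ham.le.trans ht.1, ht.2⟩) rfl hadm' (hl.trans hm.symm)
      obtain rfl := he.2 rfl
      refine ⟨none, y, by simp, Lifts.trans ?_ hy⟩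
      refine fibreConn_of_special hsp (hx.trans hξa) ?_ ξ a m ham fun t ht => ?_
      · change A.edge (lam k _) _ _ = _
        simp only [hl]
      · obtain ⟨h1, h2⟩ := h.edge t ⟨ht.1, ht.2.trans hmb⟩
        rw [h2, hx, hξa]
        simp only [hconst t ⟨ht.1, ht.2.trans hmc.le⟩]
    -- Over other values there is no freedom: `x` already lies on an edge of the required type.
    · refine direct (fun e => hsp ?_) (exists_eq_edgeH_of_not_special (hx.trans hξa) hsp)
      rw [e]
      simp [special]
  -- At an exception there is no stop in which to change the edge; `StartsAt` says that `x` is on a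
  -- usable one.
  · obtain ⟨he, r, hr⟩ := h.exc0 _ rfl
    cases he
    exact direct (hr ▸ (halfPt_ne_endpt r).symm) (hs _ _ rfl)

/-- Lifting a piece. -/
theorem exists_lifts_of_piece {e0 : Option (A.E × I)} {γ : A.E} {ω : I → I}
    (h : IsPiece A ξ e0 none a b γ ω) {x : S.H}
    (hx : S.p x = ξ a) (hs : S.StartsAt e0 x) :
    ∃ e0' y, (e0' = none ↔ e0 = none) ∧ S.Lifts ξ e0' none a b x y := by
  have hab := h.stair.lt
  have haa : a ∈ Icc a b := ⟨le_rfl, hab.le⟩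
  have hbb : b ∈ Icc a b := ⟨hab.le, le_rfl⟩
  have same : ∀ {a b : I} (_ : a ≤ b) (_ : MonotoneOn ω (Icc a b) ∨ AntitoneOn ω (Icc a b))
      {c : Bool} (_ : ω a ∈ halfSet c) (_ : ω b ∈ halfSet c), ∀ t ∈ Icc a b, ω t ∈ halfSet c := by
    intro a b hab hm c ha hb t ht
    have haa : a ∈ Icc a b := ⟨le_rfl, hab⟩
    have hbb : b ∈ Icc a b := ⟨hab, le_rfl⟩
    cases c <;> rcases hm with hm | hm
    · exact (hm ht hbb ht.2).trans hb
    · exact (hm haa ht ht.1).trans ha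
    · exact le_trans ha (hm haa ht ht.1)
    · exact le_trans hb (hm ht hbb ht.2)
  obtain ⟨c, hc⟩ := exists_mem_halfSet (ω a)
  obtain ⟨c', hc'⟩ := exists_mem_halfSet (ω b)
  by_cases hcc : ω b ∈ halfSet c
  · exact exists_lifts_of_half h (same hab.le h.stair.mono hc hcc) hx hs
  by_cases hcc' : ω a ∈ halfSet c'
  · exact exists_lifts_of_half h (same hab.le h.stair.mono hcc' hc') hx hs
  have hmem : ∀ c, halfPt ∈ halfSet c := fun c => by cases c <;> exact le_refl halfPt
  have hne : c ≠ c' := fun e => hcc (e ▸ hc')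
  obtain ⟨t, ht, hω⟩ : ∃ t ∈ Icc a b, ω t = halfPt := by
    have h1 := intermediate_value_uIcc (by rw [uIcc_of_le hab.le]; exact h.stair.cont)
    rw [uIcc_of_le hab.le] at h1
    refine h1 ?_
    rw [mem_uIcc]
    cases c <;> cases c' <;> first | exact absurd rfl hne | skip
    · exact Or.inl ⟨hc, hc'⟩
    · exact Or.inr ⟨hc', hc⟩
  -- The function crosses `1/2`, which is dyadic and not an end value, hence a stop value. Cutting
  -- in the middle of the stop leaves two pieces, each with values in one half.
  obtain ⟨c1, c2, hlt, hsub, hst⟩ := (h.stair.isStopValue_iff halfPt).2 ⟨⟨t, ht, hω⟩, isDyadic_half,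
    fun h' => hcc' (h'.2 ▸ hmem c'), fun h' => hcc (h'.2 ▸ hmem c)⟩
  obtain ⟨m, h1, h2⟩ := exists_between hlt
  have hm := hst m ⟨h1.le, h2.le⟩
  have hac1 := (hsub ⟨le_rfl, hlt.le⟩).1
  have hc2b := (hsub ⟨hlt.le, le_rfl⟩).2
  have hL := h.left h1 h2 hac1 hc2b fun t ht => (hst t ht).trans hm.symm
  have hR := h.right h1 h2 hac1 hc2b fun t ht => (hst t ht).trans hm.symm
  obtain ⟨e0', y, he, hy⟩ := exists_lifts_of_half hL
    (same hL.stair.lt.le hL.stair.mono hc (hm ▸ hmem c)) hx hs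
  obtain ⟨e1', z, he', hz⟩ := exists_lifts_of_half hR
    (same hR.stair.lt.le hR.stair.mono (hm ▸ hmem c') hc') hy.p_right (startsAt_none y)
  obtain rfl := he'.2 rfl
  exact ⟨e0', z, he, hy.trans hz⟩

/-- Lifting with given starting point. -/
theorem exists_lifts_of_chain {e0 e1 : Option (A.E × I)} (h : PieceChain A ξ e0 e1 a b)
    (he1 : e1 = none) {x : S.H} (hx : S.p x = ξ a) (hs : S.StartsAt e0 x) :
    ∃ e0' y, (e0' = none ↔ e0 = none) ∧ S.Lifts ξ e0' none a b x y := by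
  induction h generalizing x with
  | single h =>
    subst he1
    exact exists_lifts_of_piece h hx hs
  | trans _ _ i1 i2 =>
    obtain ⟨e0', y, he, hy⟩ := i1 rfl hx hs
    obtain ⟨e1', z, he', hz⟩ := i2 he1 hy.p_right (startsAt_none y)
    obtain rfl := he'.2 rfl
    exact ⟨e0', z, he, hy.trans hz⟩

/-- Lifting with given end point. -/
theorem exists_lifts_of_chain_right {e1 : Option (A.E × I)} (h : PieceChain A ξ none e1 a b)
    {y : S.H} (hy : S.p y = ξ b) (hs : S.StartsAt e1 y) :
    ∃ e1' x, (e1' = none ↔ e1 = none) ∧ S.Lifts ξ none e1' a b x y := by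
  -- Reversing time turns the prescribed end into a prescribed start.
  obtain ⟨e1', x, he, hx⟩ := exists_lifts_of_chain h.symm rfl
    (hy.trans (congrArg ξ (symm_symm b)).symm) hs
  exact ⟨e1', x, he, hx.of_symm⟩

end PathStep

/-! ## Chains of pieces and the property (P1) -/

namespace PathForm

variable {B : BuildingBlock} {ξ : I → B.G}

theorem left_mem (X : PathForm B ξ) (d : Fin (X.D + 1)) : X.τ d.castSucc ∈ X.intv d :=
  ⟨le_rfl, (X.τ_strictMono d.castSucc_lt_succ).le⟩

theorem right_mem (X : PathForm B ξ) (d : Fin (X.D + 1)) : X.τ d.succ ∈ X.intv d :=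
  ⟨(X.τ_strictMono d.castSucc_lt_succ).le, le_rfl⟩

theorem endValue_false (X : PathForm B ξ) : X.endValue false = X.ω 0 (X.τ (Fin.castSucc 0)) :=
  congrArg (X.ω 0) X.τ_zero.symm

theorem endValue_true (X : PathForm B ξ) :
    X.endValue true = X.ω (Fin.last X.D) (X.τ (Fin.last X.D).succ) :=
  congrArg (X.ω (Fin.last X.D)) X.τ_last.symm

/-- Translates the exceptional set of (P1) into the two flags of `IsStair`. -/
theorem exists_exc_iff (X : PathForm B ξ) (exc : Set Bool) (d : Fin (X.D + 1)) (w : I) :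
    (∃ r ∈ exc, d = X.endIdx r ∧ w = X.endValue r) ↔
      ((d = 0 ∧ false ∈ exc) ∧ w = X.ω d (X.τ d.castSucc)) ∨
        ((d = Fin.last X.D ∧ true ∈ exc) ∧ w = X.ω d (X.τ d.succ)) := by
  constructor
  · rintro ⟨r, hr, rfl, rfl⟩
    cases r
    · exact Or.inl ⟨⟨rfl, hr⟩, X.endValue_false⟩
    · exact Or.inr ⟨⟨rfl, hr⟩, X.endValue_true⟩
  · rintro (⟨⟨rfl, hr⟩, rfl⟩ | ⟨⟨rfl, hr⟩, rfl⟩)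
    · exact ⟨false, hr, rfl, X.endValue_false.symm⟩
    · exact ⟨true, hr, rfl, X.endValue_true.symm⟩

open Classical in
/-- The exceptional data at the endpoint `r`. -/
noncomputable def exceptionAt (X : PathForm B ξ) (exc : Set Bool) (r : Bool) :
    Option (B.E × I) :=
  if r ∈ exc then some (X.γ (X.endIdx r), X.endValue r) else none

theorem exceptionAt_eq_none_iff (X : PathForm B ξ) (exc : Set Bool) (r : Bool) :
    X.exceptionAt exc r = none ↔ r ∉ exc := by
  simp [exceptionAt]

theorem eq_of_exceptionAt_eq_some (X : PathForm B ξ) {exc : Set Bool} {r : Bool} {z : B.E × I}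
    (h : X.exceptionAt exc r = some z) :
    r ∈ exc ∧ z = (X.γ (X.endIdx r), X.endValue r) := by
  unfold exceptionAt at h
  split_ifs at h with hr
  exact ⟨hr, (Option.some.inj h).symm⟩

theorem ite_ne_none_iff {α : Type} {P Q : Prop} [Decidable P] {e : Option α} (he : e = none ↔ ¬Q) :
    (if P then e else none) ≠ none ↔ P ∧ Q := by
  split_ifs with h <;> simp [h, he]

theorem eq_some_of_ite {α : Type} {P : Prop} [Decidable P] {e : Option α} {z : α}
    (h : (if P then e else none) = some z) : P ∧ e = some z := by
  split_ifs at h with hP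
  exact ⟨hP, h⟩

theorem exists_endpt_of_mem {v : I} (h : v ∈ ({0, 1} : Set I)) : ∃ r, v = endpt r := by
  rcases h with h | h
  · exact ⟨false, h⟩
  · exact ⟨true, h⟩

/-- The pieces of a presentation with (P1). -/
theorem isPiece (X : PathForm B ξ) {exc : Set Bool} (hP1 : X.P1 exc) (hP3a : ∀ r ∈ exc, X.P3a r)
    (d : Fin (X.D + 1)) :
    IsPiece B ξ (if d = 0 then X.exceptionAt exc false else none)
      (if d = Fin.last X.D then X.exceptionAt exc true else none)
      (X.τ d.castSucc) (X.τ d.succ) (X.γ d) (X.ω d) where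
  stair := {
    lt := X.τ_strictMono d.castSucc_lt_succ
    cont := X.continuousOn d
    mono := X.monotone d
    isStopValue_iff := fun w => by
      have h1 := Set.ext_iff.1 (hP1 d) w
      have h2 := X.exists_exc_iff exc d w
      rw [ite_ne_none_iff (X.exceptionAt_eq_none_iff exc false),
        ite_ne_none_iff (X.exceptionAt_eq_none_iff exc true)]
      refine h1.trans ?_
      rw [Set.mem_sdiff, Set.mem_ofPred_eq, h2, not_or]
      exact and_assoc }
  exc0 := by
    intro z hz
    obtain ⟨rfl, hz'⟩ := eq_some_of_ite hz
    obtain ⟨hr, rfl⟩ := X.eq_of_exceptionAt_eq_some hz'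
    rw [← X.endValue_false]
    exact ⟨rfl, exists_endpt_of_mem (hP3a _ hr).1⟩
  exc1 := by
    intro z hz
    obtain ⟨rfl, hz'⟩ := eq_some_of_ite hz
    obtain ⟨hr, rfl⟩ := X.eq_of_exceptionAt_eq_some hz'
    rw [← X.endValue_true]
    exact ⟨rfl, exists_endpt_of_mem (hP3a _ hr).1⟩
  edge := fun t ht => ⟨X.adm d t ht, X.eq_edge d t ht⟩

theorem pieceChain (X : PathForm B ξ) {exc : Set Bool} (hP1 : X.P1 exc)
    (hP3a : ∀ r ∈ exc, X.P3a r) {k l : ℕ} (hkl : k + 1 ≤ l) (hl : l < X.D + 2) :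
    PieceChain B ξ (if k = 0 then X.exceptionAt exc false else none)
      (if l = X.D + 1 then X.exceptionAt exc true else none)
      (X.τ ⟨k, by omega⟩) (X.τ ⟨l, hl⟩) := by
  have key : ∀ n (hn : n + 1 < X.D + 2),
      PieceChain B ξ (if n = 0 then X.exceptionAt exc false else none)
        (if n + 1 = X.D + 1 then X.exceptionAt exc true else none)
        (X.τ ⟨n, Nat.lt_of_succ_lt hn⟩) (X.τ ⟨n + 1, hn⟩) := by
    clear hkl hl
    intro n hn
    have := X.isPiece hP1 hP3a ⟨n, by omega⟩
    simp only [Fin.ext_iff, Fin.val_zero, Fin.val_last] at this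
    simp only [Nat.add_right_cancel_iff]
    exact .single this
  induction l, hkl using Nat.le_induction with
  | base => exact key k hl
  | succ l hkl ih =>
    have h1 := ih (by omega)
    have h2 := key l hl
    -- The junction is an interior division point, so it carries no exception from either side.
    rw [if_neg (show ¬ l = X.D + 1 by omega)] at h1
    rw [if_neg (show ¬ l = 0 by omega)] at h2
    exact h1.trans h2

/-- A presentation whose parts are pieces satisfies (P1). -/
theorem P1_of_isPiece (Z : PathForm B ξ) {exc : Set Bool} {e : Bool → Option (B.E × I)}
    (he : ∀ r, e r = none ↔ r ∉ exc)
    (h : ∀ d, IsPiece B ξ (if d = 0 then e false else none)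
      (if d = Fin.last Z.D then e true else none)
      (Z.τ d.castSucc) (Z.τ d.succ) (Z.γ d) (Z.ω d)) : Z.P1 exc := by
  intro d
  ext w
  have h1 := (h d).stair.isStopValue_iff w
  rw [ite_ne_none_iff (he false), ite_ne_none_iff (he true)] at h1
  rw [Set.mem_sdiff, Set.mem_ofPred_eq, Z.exists_exc_iff exc d w, not_or]
  exact h1.trans and_assoc.symm

theorem P3a_of_isPiece (Z : PathForm B ξ) {exc : Set Bool} {e : Bool → Option (B.E × I)}
    (he : ∀ r, e r = none ↔ r ∉ exc)
    (h : ∀ d, IsPiece B ξ (if d = 0 then e false else none)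
      (if d = Fin.last Z.D then e true else none)
      (Z.τ d.castSucc) (Z.τ d.succ) (Z.γ d) (Z.ω d)) {r : Bool} (hr : r ∈ exc) : Z.P3a r := by
  have mem : ∀ {v : I}, (∃ r, v = endpt r) → v ∈ ({0, 1} : Set I) := by
    rintro _ ⟨r, rfl⟩
    cases r <;> simp [endpt]
  refine ⟨mem ?_, fun hs => ?_⟩
  · obtain ⟨z, hz⟩ := Option.ne_none_iff_exists'.1 fun hn => (he r).1 hn hr
    cases r
    · rw [Z.endValue_false]
      exact ((h 0).exc0 z (by rw [if_pos rfl, hz])).2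
    · rw [Z.endValue_true]
      exact ((h (Fin.last Z.D)).exc1 z (by rw [if_pos rfl, hz])).2
  · rw [Z.P1_of_isPiece he h] at hs
    exact hs.2 ⟨r, hr, rfl, rfl⟩

/-- A presentation of a path that passes through a vertex satisfies (P2). -/
theorem P2_of_vertex (Z : PathForm B ξ) {exc : Set Bool} (hP1 : Z.P1 exc)
    (hP3a : ∀ r ∈ exc, Z.P3a r) {m : I} (h0 : 0 < m) (h1 : m < 1) {η : B.F}
    (hm : ξ m = B.vertex η) : Z.P2 := by
  obtain ⟨d, hd⟩ : ∃ d, m ∈ Z.intv d := by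
    -- Induction on the division points finds an interval containing `m`.
    have key : ∀ n (hn : n < Z.D + 1), m ≤ Z.τ ⟨n + 1, by omega⟩ → ∃ d, m ∈ Z.intv d := by
      intro n
      induction n with
      | zero => exact fun hn hm => ⟨⟨0, hn⟩, Z.τ_zero.trans_le h0.le, hm⟩
      | succ n ih =>
        intro hn hm
        rcases le_total m (Z.τ ⟨n + 1, by omega⟩) with h | h
        · exact ih (by omega) h
        · exact ⟨⟨n + 1, hn⟩, h, hm⟩
    exact key Z.D (by omega) (h1.le.trans Z.τ_last.ge)
  obtain ⟨r, hr⟩ := B.exists_eq_endpt_of_edge_eq_vertex ((Z.eq_edge d m hd).symm.trans hm)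
  refine ⟨d, m, hd, ?_, ?_⟩
  · rw [hr]
    cases r <;> simp [special, endpt]
  · rw [hP1 d]
    refine ⟨⟨⟨m, hd, rfl⟩, ?_⟩, ?_⟩
    · rw [hr]
      cases r
      · exact isDyadic_zero
      · exact isDyadic_one
    -- If the value at `m` were an exempted end value, monotonicity would make `ω` constant between
    -- `m` and that end. As `m` is neither `0` nor `1`, this would be a stop, contrary to (P3a).
    · rintro ⟨r', hr', rfl, he⟩
      refine (hP3a r' hr').2 ?_
      cases r'
      · have hl := Z.left_mem 0
        rw [Z.endValue_false] at he ⊢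
        refine ⟨Z.τ (Fin.castSucc 0), m, (Z.τ_zero.trans_lt h0 : _), Icc_subset_Icc le_rfl hd.2,
          fun t ht => eq_of_mono_of_eq (Z.monotone 0) hl ⟨ht.1, ht.2.trans hd.2⟩ hd ht.1 ht.2
            he.symm⟩
      · have hl := Z.right_mem (Fin.last Z.D)
        rw [Z.endValue_true] at he ⊢
        refine ⟨m, Z.τ (Fin.last Z.D).succ, (h1.trans_eq Z.τ_last.symm : _),
          Icc_subset_Icc hd.1 le_rfl, fun t ht => (eq_of_mono_of_eq (Z.monotone _) hd
            ⟨hd.1.trans ht.1, ht.2⟩ hl ht.1 ht.2 he).trans he⟩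

end PathForm

/-- Flattens a nested concatenation. Indexing by `ℕ` makes joining two sequences a shift by `D + 1`;
entries past the last piece are irrelevant. -/
theorem PieceChain.exists_seq {B : BuildingBlock} {ξ : I → B.G} {e0 e1 : Option (B.E × I)} {a b : I}
    (h : PieceChain B ξ e0 e1 a b) : ∃ (D : ℕ) (τ : ℕ → I) (γ : ℕ → B.E) (ω : ℕ → I → I),
      τ 0 = a ∧ τ (D + 1) = b ∧ ∀ n ≤ D, IsPiece B ξ (if n = 0 then e0 else none)
        (if n = D then e1 else none) (τ n) (τ (n + 1)) (γ n) (ω n) := by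
  induction h with
  | @single e0 e1 a b γ ω h =>
    refine ⟨0, fun n => if n = 0 then a else b, fun _ => γ, fun _ => ω, rfl, rfl, fun n hn => ?_⟩
    obtain rfl : n = 0 := by omega
    exact h
  | @trans e0 e1 a b c _ _ i1 i2 =>
    obtain ⟨D, τ, γ, ω, h0, h1, hp⟩ := i1
    obtain ⟨D', τ', γ', ω', h0', h1', hp'⟩ := i2
    refine ⟨D + 1 + D', fun n => if n ≤ D then τ n else τ' (n - (D + 1)),
      fun n => if n ≤ D then γ n else γ' (n - (D + 1)),
      fun n => if n ≤ D then ω n else ω' (n - (D + 1)), ?_, ?_, fun n hn => ?_⟩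
    · simp [h0]
    · refine (if_neg (show ¬ D + 1 + D' + 1 ≤ D by omega)).trans ?_
      rw [← h1', show D + 1 + D' + 1 - (D + 1) = D' + 1 by omega]
    · rcases le_or_gt n D with hnD | hnD
      · have := hp n hnD
        -- For `n = D` the right end is the first point of the second sequence, which is the common
        -- point `b`.
        have e : (if n + 1 ≤ D then τ (n + 1) else τ' (n + 1 - (D + 1))) = τ (n + 1) := by
          split_ifs with hlt
          · rfl
          · obtain rfl : n = D := by omega
            rw [Nat.sub_self, h0', h1]
        rw [ite_self] at this
        simp only [if_pos hnD, e]
        rwa [if_neg (show ¬ n = D + 1 + D' by omega)]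
      · have := hp' (n - (D + 1)) (by omega)
        rw [ite_self] at this
        simp only [if_neg (show ¬ n ≤ D by omega), if_neg (show ¬ n + 1 ≤ D by omega)]
        rw [if_neg (show ¬ n = 0 by omega)]
        have e1 : n + 1 - (D + 1) = n - (D + 1) + 1 := by omega
        have e2 : (n = D + 1 + D') ↔ (n - (D + 1) = D') := by omega
        rw [e1]
        simp only [e2]
        exact this

theorem PieceChain.exists_pathForm {B : BuildingBlock} {ξ : I → B.G} {e0 e1 : Option (B.E × I)}
    (h : PieceChain B ξ e0 e1 0 1) : ∃ Z : PathForm B ξ,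
      ∀ d, IsPiece B ξ (if d = 0 then e0 else none) (if d = Fin.last Z.D then e1 else none)
        (Z.τ d.castSucc) (Z.τ d.succ) (Z.γ d) (Z.ω d) := by
  obtain ⟨D, τ, γ, ω, h0, h1, hp⟩ := h.exists_seq
  have hp' : ∀ d : Fin (D + 1), IsPiece B ξ (if d = 0 then e0 else none)
      (if d = Fin.last D then e1 else none) (τ d) (τ (d + 1)) (γ d) (ω d) := fun d => by
    simp only [Fin.ext_iff, Fin.val_zero, Fin.val_last]
    exact hp d (by omega)
  exact ⟨{
    D := D
    τ := fun n => τ n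
    τ_strictMono := Fin.strictMono_iff_lt_succ.2 fun d => (hp' d).stair.lt
    τ_zero := h0
    τ_last := h1
    γ := fun n => γ n
    ω := fun n => ω n
    continuousOn := fun d => (hp' d).stair.cont
    monotone := fun d => (hp' d).stair.mono
    adm := fun d t ht => ((hp' d).edge t ht).1
    eq_edge := fun d t ht => ((hp' d).edge t ht).2 }, hp'⟩

/-! ### The lifting theorem -/

namespace PathForm

/-- The property (P3b) determines the start of a lift. -/
theorem P3b.startsAt {A : BuildingBlock} {S : PathStep A} {ξ : I → A.G} {X : PathForm A ξ}
    {exc : Set Bool} {r : Bool} {h : S.H} (hh : S.p h = ξ (endpt r)) (hP3a : r ∈ exc → X.P3a r)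
    (hP3b : r ∈ exc → X.P3b S r h) : S.StartsAt (X.exceptionAt exc r) h := by
  intro γ v hv
  obtain ⟨hr, hz⟩ := X.eq_of_exceptionAt_eq_some hv
  cases hz
  obtain ⟨w, q, k, p, μ, u, hadm, rfl, hγ, t₀, ht₀, hval⟩ := hP3b hr
  refine ⟨q, k, p, μ, u, endpt w, hadm, rfl, hγ, ?_⟩
  obtain ⟨r', hr'⟩ := exists_endpt_of_mem (hP3a hr).1
  have hmem : endpt r ∈ X.intv (X.endIdx r) := by
    cases r
    · have := X.left_mem 0
      rwa [show X.τ (Fin.castSucc 0) = endpt false from X.τ_zero] at this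
    · have := X.right_mem (Fin.last X.D)
      rwa [show X.τ (Fin.last X.D).succ = endpt true from X.τ_last] at this
  -- The endpoint itself is one of the times for which (P3b) places the values of `ω` in the image
  -- of `λ_μ`.
  have hrange : X.endValue r ∈ range (lam k) := by
    cases r
    · have : (0 : I) < t₀ := ht₀.1.2
      exact hval 0 (X.τ_zero.trans_lt this) _ hmem this.le
    · have : t₀ < 1 := ht₀.1.2
      exact hval (Fin.last X.D) (this.trans_eq X.τ_last.symm) _ hmem this.le
  -- Both sides are vertices, so this equality only shows that `λ_μ(w) ∈ {0,1}`. It is the end value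
  -- because the image of `λ_μ` contains at most one of `0` and `1`.
  have e : A.edge (lam k (endpt w)) _ (S.adm_lam hadm) =
      A.edge (X.endValue r) _ (X.adm _ _ hmem) := hh.trans (X.eq_edge _ _ hmem)
  obtain ⟨η, hη⟩ := A.exists_edge_endpt (X.adm _ _ hmem) hr'
  obtain ⟨s', hs'⟩ := A.exists_eq_endpt_of_edge_eq_vertex (e.trans hη)
  obtain ⟨s₀, hs₀⟩ := hrange
  rw [hs', hr', endpt_eq_of_lam hs' (hs₀.trans hr')]

end PathForm

/-- The path-lifting property: `exc = ∅` is the main statement, and the other values of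
`exc ⊆ {0,1}` are the variation at the endpoints `𝔯 ∈ exc`. -/
theorem proposition4p2 (A : BuildingBlock) (S : PathStep A) (exc : Set Bool)
    (ξ : unitInterval → A.G) (hξ : Continuous ξ)
    (X : PathForm A ξ) (hP1 : X.P1 exc) (hP2 : X.P2)
    (h : Bool → S.H) (hh : ∀ r, S.p (h r) = ξ (endpt r))
    (hP3a : ∀ r ∈ exc, X.P3a r) (hP3b : ∀ r ∈ exc, X.P3b S r (h r)) :
    ∃ ζ : unitInterval → S.H, Continuous ζ ∧
      (∃ Z : PathForm S.next (S.incl ∘ ζ), Z.P1 exc ∧ Z.P2 ∧ ∀ r ∈ exc, Z.P3a r) ∧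
      (∀ r, ζ (endpt r) = h r) ∧
      ∀ t, S.p (ζ t) = ξ t := by
  -- Inside the stop from (P2) times `c < m < c'` are chosen: lifts from the two ends extend to `c`
  -- and to `c'`, and the lift will be at a vertex at time `m`.
  obtain ⟨d, t, ht, hsp, c1, c2, hc, hsub, hst⟩ := hP2
  obtain ⟨m, h1m, hm2⟩ := exists_between hc
  obtain ⟨c, h1c, hcm⟩ := exists_between h1m
  obtain ⟨c', hmc', hc'2⟩ := exists_between hm2
  have hac1 := (hsub ⟨le_rfl, hc.le⟩).1
  have hc2b := (hsub ⟨hc.le, le_rfl⟩).2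
  have hconst : ∀ s ∈ Icc c1 c2, ∀ s' ∈ Icc c1 c2, X.ω d s = X.ω d s' := fun s hs s' hs' =>
    (hst s hs).trans (hst s' hs').symm
  have hmc : m ∈ Icc c1 c2 := ⟨h1m.le, hm2.le⟩
  have hcc : c ∈ Icc c1 c2 := ⟨h1c.le, hcm.le.trans hm2.le⟩
  have hcc' : c' ∈ Icc c1 c2 := ⟨h1m.le.trans hmc'.le, hc'2.le⟩
  have hpiece := X.isPiece hP1 hP3a d
  have hL : PieceChain A ξ (X.exceptionAt exc false) none 0 c := by
    have := PieceChain.single (hpiece.left h1c (hcm.trans hm2) hac1 hc2b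
      fun s hs => hconst s hs c hcc)
    by_cases hd : d = 0
    · subst hd
      rw [if_pos rfl] at this
      rwa [show X.τ (Fin.castSucc 0) = 0 from X.τ_zero] at this
    · rw [if_neg hd] at this
      have hd' : d.val ≠ 0 := fun e => hd (Fin.ext e)
      have h1 := X.pieceChain hP1 hP3a (k := 0) (l := d.val) (by omega) (by omega)
      rw [if_pos rfl, if_neg (by omega)] at h1
      rw [show X.τ ⟨0, by omega⟩ = 0 from X.τ_zero] at h1
      exact h1.trans this
  have hR : PieceChain A ξ none (X.exceptionAt exc true) c' 1 := by
    have := PieceChain.single (hpiece.right (h1m.trans hmc') hc'2 hac1 hc2b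
      fun s hs => hconst s hs c' hcc')
    by_cases hd : d = Fin.last X.D
    · subst hd
      rw [if_pos rfl] at this
      rwa [show X.τ (Fin.last X.D).succ = 1 from X.τ_last] at this
    · rw [if_neg hd] at this
      have hd' : d.val ≠ X.D := fun e => hd (Fin.ext e)
      have h1 := X.pieceChain hP1 hP3a (k := d.val + 1) (l := X.D + 1) (by omega) (by omega)
      rw [if_pos rfl, if_neg (by omega)] at h1
      rw [show X.τ ⟨X.D + 1, by omega⟩ = 1 from X.τ_last] at h1
      exact this.trans h1
  -- The two parts are lifted independently, each from its prescribed end; `y` and `z` are the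
  -- uncontrolled inner ends.
  obtain ⟨e0, y, he0, hy⟩ := PathStep.exists_lifts_of_chain hL rfl (hh false)
    (PathForm.P3b.startsAt (hh false) (hP3a _) (hP3b _))
  obtain ⟨e1, z, he1, hz⟩ := PathStep.exists_lifts_of_chain_right hR (hh true)
    (PathForm.P3b.startsAt (hh true) (hP3a _) (hP3b _))
  have hv : X.ω d m ∈ special := by
    rwa [hst m hmc]
  have hξm : ∀ s ∈ Icc c1 c2, ξ s = A.edge (X.ω d m) (X.γ d) (X.adm d m (hsub hmc)) := by
    intro s hs
    rw [X.eq_edge d s (hsub hs)]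
    simp only [hconst s hs m hmc]
  have hyp := hy.p_right.trans (hξm c hcc)
  have hzp : S.p z = _ := hz.p_left.trans (hξm c' hcc')
  -- Both `y` and `z` lie over the point of the stop, whose fibre is connected. The connection goes
  -- from `y` to a vertex on `[c,m]`, and from this vertex to `z` on `[m,c']`.
  obtain ⟨η, hη⟩ := PathStep.exists_fibreConn_vertexH hv hyp
  have hηz := PathStep.fibreConn_of_special hv (hη.p_eq.trans hyp) hzp
  have h1 := hy.trans (hη ξ c m hcm fun s hs =>
    (hξm s ⟨h1c.le.trans hs.1, hs.2.trans hm2.le⟩).trans hyp.symm)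
  have h2 := (hηz ξ m c' hmc' fun s hs => (hξm s ⟨h1m.le.trans hs.1, hs.2.trans hc'2.le⟩).trans
    (hη.p_eq.trans hyp).symm).trans hz
  obtain ⟨ζ, hζc, hζ0, hζm, hζ1, hζp, hchain⟩ := h1.exists_trans h2
  obtain ⟨Z, hZ⟩ := hchain.exists_pathForm
  -- The lift has exceptions at the same ends as the given path.
  have he : ∀ r, (fun r => cond r e1 e0) r = none ↔ r ∉ exc := by
    intro r
    cases r
    · exact he0.trans (X.exceptionAt_eq_none_iff exc false)
    · exact he1.trans (X.exceptionAt_eq_none_iff exc true)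
  have hZ1 := Z.P1_of_isPiece he hZ
  have hZ3 : ∀ r ∈ exc, Z.P3a r := fun r hr => Z.P3a_of_isPiece he hZ hr
  have hI : Icc (0 : I) 1 = univ := eq_univ_of_forall fun s => ⟨nonneg', le_one'⟩
  refine ⟨ζ, ?_, ⟨Z, hZ1, Z.P2_of_vertex hZ1 hZ3 (η := S.inclF η) h1.lt h2.lt
    (congrArg S.incl hζm), hZ3⟩, ?_, fun s => hζp s (hI ▸ mem_univ s)⟩
  · rwa [← continuousOn_univ, ← hI]
  · intro r
    cases r
    · exact hζ0
    · exact hζ1
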